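/- Let $Y=\mathbb{R}$ and $\phi(y)=y^3/3$, or $Y=S^1=\mathbb{R}/2\pi\mathbb{Z}$ and $\phi(y)=\sin y$. For $h>0$ and $\xi\in\mathbb{R}$ let $$P_\xi = h\partial_y+\xi+\partial_y\phi$$ be the unbounded operator on $L^2(Y)$ with domain $\{u\in L^2(\mathbb{R}):\ (1+y^4)^{1/2}u\in L^2(\mathbb{R}),\ u'\in L^2(\mathbb{R})\}$ if $Y=\mathbb{R}$, and $H^1(S^1)$ if $Y=S^1$. The spectrum of $P_\xi^*P_\xi$ is purely discrete; let $0\le t_0(P_\xi)\le t_1(P_\xi)\le\dots\to+\infty$ be the singular values of $P_\xi$, i.e. the square roots of the eigenvalues of $P_\xi^*P_\xi$ counted with multiplicity. 1. Let $K$ be a compact ($h$-independent) subset of $]-\infty,0[$ if $Y=\mathbb{R}$, and of $]-1,1[$ if $Y=S^1$. There are constants $C>0$ and $h_0>0$ such that for all $h\in\,]0,h_0]$ and all $\xi\in K$ $$t_1(P_\xi)\ \ge\ \frac{h^{1/2}}{C}.$$ 2. Let $Y=\mathbb{R}$. For every $C_0>0$ there are $C>0$ and $h_0>0$ such that for all $h\in\,]0,h_0]$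 and all $\xi\in\mathbb{R}$ with $C_0h^{2/3}\le-\xi\le 1/C_0$ or $-\xi\ge C_0$ $$t_1(P_\xi)\ \ge\ \frac{h^{1/2}|\xi|^{1/4}}{C}.$$ 3. Let $Y=S^1$. For every $C_0>0$ there are $C>0$ and $h_0>0$ such that for all $h\in\,]0,h_0]$ and all $\xi\in\mathbb{R}$ with $C_0h^{2/3}\le 1+\xi\le 1/C_0$ or $C_0h^{2/3}\le 1-\xi\le 1/C_0$ $$t_1(P_\xi)\ \ge\ \frac{h^{1/2}\,\bigl|1-|\xi|\bigr|^{1/4}}{C}.$$ -/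

import Mathlib

open MeasureTheory Filter Set
open scoped ContDiff ENNReal

noncomputable section

namespace SmallSV

instance factTwoPiPos : Fact (0 < 2 * Real.pi) := ⟨Real.two_pi_pos⟩

/-- The circle `ℝ / 2πℤ`, with its Lebesgue measure `volume` of total mass `2π`. -/
abbrev Circ : Type := AddCircle (2 * Real.pi)

/-! ### Weak derivatives -/

/-- Test functions on a one-dimensional space `Y`: a set of pairs `(φ, φ')`, where `φ` is a test
function and `φ'` is its classical derivative. The two instances below are `C_c^∞(ℝ)` and
`C^∞(ℝ / 2πℤ)`. The two fields only record what makes weak derivatives in `L²` well defined. -/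
structure TestClass {Y : Type*} [MeasurableSpace Y] (μ : Measure Y) where
  pairs : Set ((Y → ℂ) × (Y → ℂ))
  memLp : ∀ p ∈ pairs, MemLp p.1 2 μ ∧ MemLp p.2 2 μ
  separating : ∀ v : Lp ℂ 2 μ, (∀ p ∈ pairs, ∫ y, v y * p.1 y ∂μ = 0) → v = 0

section Generic

variable {Y : Type*} [MeasurableSpace Y] {μ : Measure Y}

/-- `v` is the weak derivative of `u`: `∫ u φ' = - ∫ v φ` for all test functions `φ`. -/
def IsWeakDeriv (T : TestClass μ) (u v : Lp ℂ 2 μ) : Prop :=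
  ∀ p ∈ T.pairs, ∫ y, u y * p.2 y ∂μ = -∫ y, v y * p.1 y ∂μ

theorem integrable_mul_test (u : Lp ℂ 2 μ) {φ : Y → ℂ} (hφ : MemLp φ 2 μ) :
    Integrable (fun y => u y * φ y) μ :=
  MemLp.integrable_mul (Lp.memLp u) hφ

theorem integral_add_mul (u v : Lp ℂ 2 μ) {φ : Y → ℂ} (hφ : MemLp φ 2 μ) :
    ∫ y, (u + v : Lp ℂ 2 μ) y * φ y ∂μ = ∫ y, u y * φ y ∂μ + ∫ y, v y * φ y ∂μ := by
  rw [← integral_add (integrable_mul_test u hφ) (integrable_mul_test v hφ)]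
  refine integral_congr_ae ?_
  filter_upwards [Lp.coeFn_add u v] with y hy
  rw [hy, Pi.add_apply, add_mul]

theorem integral_smul_mul (c : ℂ) (u : Lp ℂ 2 μ) (φ : Y → ℂ) :
    ∫ y, (c • u : Lp ℂ 2 μ) y * φ y ∂μ = c * ∫ y, u y * φ y ∂μ := by
  rw [← integral_const_mul]
  refine integral_congr_ae ?_
  filter_upwards [Lp.coeFn_smul c u] with y hy
  rw [hy, Pi.smul_apply, smul_eq_mul, mul_assoc]

theorem IsWeakDeriv.add {T : TestClass μ} {u u' v v' : Lp ℂ 2 μ}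
    (h : IsWeakDeriv T u v) (h' : IsWeakDeriv T u' v') : IsWeakDeriv T (u + u') (v + v') := by
  intro p hp
  rw [integral_add_mul _ _ (T.memLp p hp).2, integral_add_mul _ _ (T.memLp p hp).1,
    h p hp, h' p hp]
  ring

theorem IsWeakDeriv.smul {T : TestClass μ} {u v : Lp ℂ 2 μ} (c : ℂ)
    (h : IsWeakDeriv T u v) : IsWeakDeriv T (c • u) (c • v) := by
  intro p hp
  rw [integral_smul_mul, integral_smul_mul, h p hp]
  ring

theorem IsWeakDeriv.unique {T : TestClass μ} {u v w : Lp ℂ 2 μ}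
    (h : IsWeakDeriv T u v) (h' : IsWeakDeriv T u w) : v = w := by
  have h1 : v + (-1 : ℂ) • w = 0 := by
    refine T.separating _ fun p hp => ?_
    rw [integral_add_mul _ _ (T.memLp p hp).1, integral_smul_mul]
    have := (h p hp).symm.trans (h' p hp)
    linear_combination -this
  rwa [neg_one_smul, add_neg_eq_zero] at h1

/-! ### The operators `h ∂_y + m(y)` -/

/-- The space of all `u ∈ L²` with weak derivative in `L²` and with `w u ∈ L²`. -/
def weightedH1 (T : TestClass μ) (w : Y → ℝ) : Submodule ℂ (Lp ℂ 2 μ) where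
  carrier := {u | MemLp (fun y => (w y : ℂ) * u y) 2 μ ∧ ∃ v : Lp ℂ 2 μ, IsWeakDeriv T u v}
  zero_mem' := by
    refine ⟨?_, 0, ?_⟩
    · refine (memLp_congr_ae ?_).2 (MemLp.zero' (ε := ℂ))
      filter_upwards [Lp.coeFn_zero ℂ 2 μ] with y hy
      rw [hy]; simp
    · have h0 : ∀ φ : Y → ℂ, ∫ y, (0 : Lp ℂ 2 μ) y * φ y ∂μ = 0 := fun φ => by
        simpa using integral_smul_mul (0 : ℂ) (0 : Lp ℂ 2 μ) φ
      intro p _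
      rw [h0, h0, neg_zero]
  add_mem' := by
    rintro u u' ⟨hu, v, hv⟩ ⟨hu', v', hv'⟩
    refine ⟨?_, v + v', hv.add hv'⟩
    refine (memLp_congr_ae ?_).2 (hu.add hu')
    filter_upwards [Lp.coeFn_add u u'] with y hy
    rw [hy, Pi.add_apply, Pi.add_apply, mul_add]
  smul_mem' := by
    rintro c u ⟨hu, v, hv⟩
    refine ⟨?_, c • v, hv.smul c⟩
    refine (memLp_congr_ae ?_).2 (hu.const_smul c)
    filter_upwards [Lp.coeFn_smul c u] with y hy
    simp only [hy, Pi.smul_apply, smul_eq_mul]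
    ring

/-- The weak derivative of an element of `weightedH1`. -/
def weakDeriv {T : TestClass μ} {w : Y → ℝ} (u : weightedH1 T w) : Lp ℂ 2 μ :=
  u.2.2.choose

theorem weakDeriv_spec {T : TestClass μ} {w : Y → ℝ} (u : weightedH1 T w) :
    IsWeakDeriv T u (weakDeriv u) :=
  u.2.2.choose_spec

theorem memLp_mul {T : TestClass μ} {w m : Y → ℝ} (hm : AEStronglyMeasurable m μ)
    (hmw : ∃ c : ℝ, ∀ y, |m y| ≤ c * w y) (u : weightedH1 T w) :
    MemLp (fun y => (m y : ℂ) * (u : Lp ℂ 2 μ) y) 2 μ := by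
  obtain ⟨c, hc⟩ := hmw
  refine MemLp.of_le_mul (c := |c|) u.2.1 ?_ (ae_of_all _ fun y => ?_)
  · exact (Complex.continuous_ofReal.comp_aestronglyMeasurable hm).mul
      (Lp.memLp (u : Lp ℂ 2 μ)).1
  · rw [norm_mul, norm_mul, ← mul_assoc, Complex.norm_real, Complex.norm_real,
      Real.norm_eq_abs, Real.norm_eq_abs, ← abs_mul]
    exact mul_le_mul_of_nonneg_right ((hc y).trans (le_abs_self _)) (norm_nonneg _)

/-- The unbounded operator `u ↦ h u' + m u` on `L²`, with domain `weightedH1 T w`. -/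
def firstOrderOp (T : TestClass μ) (w m : Y → ℝ) (hm : AEStronglyMeasurable m μ)
    (hmw : ∃ c : ℝ, ∀ y, |m y| ≤ c * w y) (h : ℝ) : Lp ℂ 2 μ →ₗ.[ℂ] Lp ℂ 2 μ where
  domain := weightedH1 T w
  toFun :=
    { toFun := fun u => (h : ℂ) • weakDeriv u + (memLp_mul hm hmw u).toLp
      map_add' := by
        intro u u'
        have h1 : weakDeriv (u + u') = weakDeriv u + weakDeriv u' :=
          (weakDeriv_spec (u + u')).unique ((weakDeriv_spec u).add (weakDeriv_spec u'))
        have h2 : (memLp_mul hm hmw (u + u')).toLp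
            = (memLp_mul hm hmw u).toLp + (memLp_mul hm hmw u').toLp := by
          rw [← MemLp.toLp_add]
          refine MemLp.toLp_congr _ _ ?_
          filter_upwards [Lp.coeFn_add (u : Lp ℂ 2 μ) u'] with y hy
          rw [Submodule.coe_add, hy, Pi.add_apply, Pi.add_apply, mul_add]
        rw [h1, h2, smul_add]
        abel
      map_smul' := by
        intro c u
        have h1 : weakDeriv (c • u) = c • weakDeriv u :=
          (weakDeriv_spec (c • u)).unique ((weakDeriv_spec u).smul c)
        have h2 : (memLp_mul hm hmw (c • u)).toLp = c • (memLp_mul hm hmw u).toLp := by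
          rw [← MemLp.toLp_const_smul]
          refine MemLp.toLp_congr _ _ ?_
          filter_upwards [Lp.coeFn_smul c (u : Lp ℂ 2 μ)] with y hy
          simp only [Submodule.coe_smul, hy, Pi.smul_apply, smul_eq_mul]
          ring
        rw [h1, h2, RingHom.id_apply, smul_add, smul_comm] }

end Generic

/-! ### The two model operators -/

/-- `C_c^∞(ℝ)`. -/
def lineTests : TestClass (volume : Measure ℝ) where
  pairs := {p | ContDiff ℝ ∞ p.1 ∧ HasCompactSupport p.1 ∧ p.2 = deriv p.1}
  memLp := by
    rintro ⟨φ, ψ⟩ ⟨h1, h2, h3⟩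
    dsimp only at h1 h2 h3 ⊢
    subst h3
    exact ⟨h1.continuous.memLp_of_hasCompactSupport h2,
      (h1.continuous_deriv (by simp)).memLp_of_hasCompactSupport h2.deriv⟩
  separating := by
    intro v hv
    have h0 : ∀ᵐ y ∂(volume : Measure ℝ), v y = 0 := by
      refine ae_eq_zero_of_integral_contDiff_smul_eq_zero
        ((Lp.memLp v).locallyIntegrable (by norm_num)) fun g hg hgc => ?_
      have := hv (fun y => (g y : ℂ), deriv fun y => (g y : ℂ))
        ⟨Complex.ofRealCLM.contDiff.comp hg, hgc.comp_left Complex.ofReal_zero, rfl⟩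
      simpa [mul_comm] using this
    exact (Lp.eq_zero_iff_ae_eq_zero).2 h0

/-- `C^∞(ℝ / 2πℤ)`: functions on the circle whose `2π`-periodic lift to `ℝ` is smooth. -/
def circTests : TestClass (volume : Measure Circ) where
  pairs := {p | ContDiff ℝ ∞ (fun y : ℝ => p.1 (y : Circ)) ∧
    ∀ y : ℝ, p.2 (y : Circ) = deriv (fun s : ℝ => p.1 (s : Circ)) y}
  memLp := by
    rintro ⟨φ, ψ⟩ ⟨h1, h2⟩
    dsimp only at h1 h2 ⊢
    have key : ∀ f : Circ → ℂ, Continuous (fun y : ℝ => f (y : Circ)) →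
        MemLp f 2 (volume : Measure Circ) := fun f hf => by
      have hc : Continuous f := isQuotientMap_quotient_mk'.continuous_iff.2 hf
      exact hc.memLp_of_hasCompactSupport (HasCompactSupport.of_compactSpace f)
    refine ⟨key φ h1.continuous, key ψ ?_⟩
    simp only [h2]
    exact h1.continuous_deriv (by simp)
  separating := by
    intro v hv
    have hv2 : MemLp (v : Circ → ℂ) 2 (AddCircle.haarAddCircle (T := 2 * Real.pi)) :=
      memLp_haarAddCircle_iff.2 (Lp.memLp v)
    have hcoef : ∀ n : ℤ, fourierCoeff (v : Circ → ℂ) n = 0 := by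
      intro n
      have hs : ContDiff ℝ ∞ (fun y : ℝ => fourier (T := 2 * Real.pi) (-n) (y : Circ)) := by
        simp only [fourier_coe_apply]
        exact Complex.contDiff_exp.comp
          ((contDiff_const.mul Complex.ofRealCLM.contDiff).div_const _)
      have hper : Function.Periodic
          (deriv fun s : ℝ => fourier (T := 2 * Real.pi) (-n) (s : Circ)) (2 * Real.pi) := by
        intro y
        rw [← deriv_comp_add_const]
        simp only [AddCircle.coe_add_period]
      have := hv (fourier (T := 2 * Real.pi) (-n), hper.lift) ⟨hs, fun y => hper.lift_coe y⟩
      rw [fourierCoeff, AddCircle.integral_haarAddCircle]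
      simp only [smul_eq_mul]
      rw [integral_congr_ae (ae_of_all _ fun y => mul_comm _ (v y)), this, smul_zero]
    have hz : hv2.toLp = 0 := by
      apply (fourierBasis (T := 2 * Real.pi)).repr.injective
      ext n
      rw [fourierBasis_repr, fourierCoeff_congr_ae hv2.coeFn_toLp, hcoef n, map_zero]
      rfl
    have hz' : ∀ᵐ y ∂(AddCircle.haarAddCircle (T := 2 * Real.pi)), v y = 0 := by
      filter_upwards [hv2.coeFn_toLp, Lp.eq_zero_iff_ae_eq_zero.1 hz] with y h1 h2
      rw [← h1, h2]; rfl
    refine Lp.eq_zero_iff_ae_eq_zero.2 ?_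
    have hz2 := Measure.ae_smul_measure hz' (ENNReal.ofReal (2 * Real.pi))
    rw [← AddCircle.volume_eq_smul_haarAddCircle] at hz2
    exact hz2

theorem line_bound (ξ : ℝ) : ∃ c : ℝ, ∀ y : ℝ, |ξ + y ^ 2| ≤ c * Real.sqrt (1 + y ^ 4) := by
  refine ⟨|ξ| + 1, fun y => (abs_add_le _ _).trans ?_⟩
  have h1 : (1 : ℝ) ≤ Real.sqrt (1 + y ^ 4) := Real.one_le_sqrt.2 (by nlinarith [sq_nonneg (y ^ 2)])
  have h2 : |y ^ 2| ≤ Real.sqrt (1 + y ^ 4) := Real.abs_le_sqrt (by nlinarith)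
  nlinarith [abs_nonneg ξ]

/-- `P_ξ = h ∂_y + ξ + ∂_y φ` on `L²(ℝ)` for `φ(y) = y³ / 3`, with domain
`{u ∈ L²(ℝ); (1 + y⁴)^{1/2} u ∈ L²(ℝ), u' ∈ L²(ℝ)}`. -/
def PLine (h ξ : ℝ) : Lp ℂ 2 (volume : Measure ℝ) →ₗ.[ℂ] Lp ℂ 2 (volume : Measure ℝ) :=
  firstOrderOp lineTests (fun y => Real.sqrt (1 + y ^ 4)) (fun y => ξ + y ^ 2)
    (by fun_prop) (line_bound ξ) h

/-- The cosine as a function on `ℝ / 2πℤ`. -/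
def circCos : Circ → ℝ := Real.cos_periodic.lift

theorem continuous_circCos : Continuous circCos :=
  isQuotientMap_quotient_mk'.continuous_iff.2 Real.continuous_cos

theorem circ_bound (ξ : ℝ) : ∃ c : ℝ, ∀ y : Circ, |ξ + circCos y| ≤ c * 1 := by
  refine ⟨|ξ| + 1, fun y => ?_⟩
  induction y using QuotientAddGroup.induction_on with
  | H y =>
    have h1 : circCos (y : Circ) = Real.cos y := Real.cos_periodic.lift_coe y
    have := abs_add_le ξ (Real.cos y)
    have := Real.abs_cos_le_one y
    rw [h1]
    linarith

/-- `P_ξ = h ∂_y + ξ + ∂_y φ` on `L²(ℝ / 2πℤ)` for `φ(y) = sin y`, with domain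
`H¹(ℝ / 2πℤ)`. -/
def PCirc (h ξ : ℝ) : Lp ℂ 2 (volume : Measure Circ) →ₗ.[ℂ] Lp ℂ 2 (volume : Measure Circ) :=
  firstOrderOp circTests (fun _ => 1) (fun y => ξ + circCos y)
    (continuous_const.add continuous_circCos).aestronglyMeasurable (circ_bound ξ) h

/-! ### Singular values -/

/-- `u` lies in the domain of `A* A` and `A* A u = l u`. -/
def IsEigenpair {H : Type*} [NormedAddCommGroup H] [InnerProductSpace ℂ H] [CompleteSpace H]
    (A : H →ₗ.[ℂ] H) (l : ℝ) (u : H) : Prop :=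
  ∃ (hu : u ∈ A.domain) (hAu : A ⟨u, hu⟩ ∈ A.adjoint.domain),
    A.adjoint ⟨A ⟨u, hu⟩, hAu⟩ = (l : ℂ) • u

/-- The spectrum of `A* A` is purely discrete, and `t 0 ≤ t 1 ≤ … → ∞` are the singular values of
`A`, i.e. the square roots of the eigenvalues of `A* A`, counted with multiplicity: there is a
Hilbert basis of eigenvectors of `A* A` with the eigenvalues `(t k)²`. -/
structure IsSingularValueSeq {H : Type*} [NormedAddCommGroup H] [InnerProductSpace ℂ H]
    [CompleteSpace H] (A : H →ₗ.[ℂ] H) (t : ℕ → ℝ) : Prop where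
  nonneg : ∀ k, 0 ≤ t k
  mono : Monotone t
  tendsto : Tendsto t atTop atTop
  basis : ∃ e : HilbertBasis ℕ ℂ H, ∀ k, IsEigenpair A (t k ^ 2) (e k)

end SmallSV

end

noncomputable section

namespace SmallSV

/-! ### Singular values of closed operators that are coercive up to finite codimension -/

section Abstract

variable {H : Type*} [NormedAddCommGroup H] [InnerProductSpace ℂ H] [CompleteSpace H]

/-! Write `m = ξ + φ'`, so that the operator is `U ↦ h U' + m U`. The formal null solution `exp (-∫
m / h)` peaks where `m` crosses zero upwards. On the line with `ξ < 0`, and on the circle with `|ξ|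
< 1`, there is exactly one such point `a`. The resulting approximate null vector can make `t 0`
tiny, but the single linear condition `U a = 0` removes it. By min-max (`le_of_coercive`), a bound
`κ ‖u‖ ≤ ‖P u‖` under one linear condition gives `t 1 ≥ κ`.

That bound comes from the multiplier method (`IsPrimitive.multiplier_estimate`). The real part of
the pairing of `h U' + m U` with `w U` is `∫ (m w - (h / 2) w') |U|²` plus boundary terms. Where `m
≥ 0`, take `w` decreasing with values in `[1, 5]`. Away from the zeros of `m` the term `m w` is
large; near them `-(h / 2) w'` takes over. If `m` grows with slope `s`, the two balance at `κ = √(h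
s)` (`IsPrimitive.estimate_of_min_le`), and the boundary term is harmful only at the left end. Where
`m ≤ 0` the mirror image holds, with harm only at the right end. Every harmful end is the point `a`
(up to a period), or `-∞` on the line, where square integrability disposes of it. The slope is of
order `|ξ|^(1/2)` on the line and `|1 - |ξ||^(1/2)` on the circle, which produces the powers `1/4`.
When `|ξ| > 1` the circle is a single interval cut where `|m|` is smallest.

The singular values must also be shown to exist. Vanishing at finitely many points makes the
operator as coercive as desired (`exists_finset_estimate`), so its graph embeds compactly in `L²`.
Then `(1 + A* A)⁻¹` is a compact positive operator, and its eigenvectors form the required Hilbert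
basis (`exists_isSingularValueSeq`).

Weak derivatives enter through locally absolutely continuous representatives: these give point
evaluations a meaning and justify the integrations by parts. -/

theorem IsEigenpair.inner_apply {A : H →ₗ.[ℂ] H} (hA : Dense (A.domain : Set H)) {l : ℝ} {u : H}
    (hu : u ∈ A.domain) (h : IsEigenpair A l u) (y : A.domain) :
    inner ℂ (A ⟨u, hu⟩) (A y) = (l : ℂ) * inner ℂ u (y : H) := by
  obtain ⟨_, hAu, h⟩ := h
  have := A.adjoint_isFormalAdjoint hA ⟨A ⟨u, hu⟩, hAu⟩ y
  rw [h, inner_smul_left, Complex.conj_ofReal] at this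
  exact this.symm

/-- If `‖A u‖ ≥ κ ‖u‖` on a subspace of codimension at most `k`, then `t k ≥ κ`. -/
theorem le_of_coercive {A : H →ₗ.[ℂ] H} (hA : Dense (A.domain : Set H)) {t : ℕ → ℝ} {e : ℕ → H}
    (he : Orthonormal ℂ e) (heig : ∀ k, IsEigenpair A (t k ^ 2) (e k)) (ht : ∀ k, 0 ≤ t k)
    (hmono : Monotone t) {ι : Type*} [Fintype ι] (L : A.domain →ₗ[ℂ] (ι → ℂ)) {κ : ℝ}
    (hL : ∀ u : A.domain, L u = 0 → κ * ‖(u : H)‖ ≤ ‖A u‖) {k : ℕ} (hk : Fintype.card ι ≤ k) :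
    κ ≤ t k := by
  have hmem : ∀ i, e i ∈ A.domain := fun i => (heig i).1
  let v : Fin (k + 1) → A.domain := fun i => ⟨e i, hmem i⟩
  let M : (Fin (k + 1) → ℂ) →ₗ[ℂ] (ι → ℂ) := L ∘ₗ Fintype.linearCombination ℂ v
  -- The `k + 1` vectors `e 0, …, e k` outnumber the at most `k` linear conditions, so some
  -- nontrivial combination satisfies them all.
  have hker : LinearMap.ker M ≠ ⊥ := by
    apply LinearMap.ker_ne_bot_of_finrank_lt
    simp only [Module.finrank_fintype_fun_eq_card, Fintype.card_fin]
    omega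
  obtain ⟨c, hc, hc0⟩ := Submodule.exists_mem_ne_zero_of_ne_bot hker
  set u : A.domain := Fintype.linearCombination ℂ v c with hu
  have hLu : L u = 0 := hc
  have hucoe : (u : H) = ∑ i, c i • e i := by
    simp [hu, Fintype.linearCombination_apply, v]
  have he' : Orthonormal ℂ (fun i : Fin (k + 1) => e i) := he.comp _ Fin.val_injective
  have hinner : ∀ i : Fin (k + 1), inner ℂ (e i) (u : H) = c i := fun i => by
    rw [hucoe]; exact he'.inner_right_fintype c i
  have hAu : A u = ∑ i, c i • A (v i) := by
    rw [hu, Fintype.linearCombination_apply, ← LinearPMap.toFun_eq_coe, map_sum]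
    simp
  have h1 : ‖(u : H)‖ ^ 2 = ∑ i, ‖c i‖ ^ 2 := by
    have : inner ℂ (u : H) (u : H) = ((∑ i, ‖c i‖ ^ 2 : ℝ) : ℂ) := by
      conv_lhs => rw [hucoe, sum_inner]
      push_cast
      refine Finset.sum_congr rfl fun i _ => ?_
      rw [inner_smul_left, ← hucoe, hinner, Complex.conj_mul']
    rw [← inner_self_eq_norm_sq (𝕜 := ℂ), this]
    exact Complex.ofReal_re _
  have h2 : ‖A u‖ ^ 2 = ∑ i : Fin (k + 1), t i ^ 2 * ‖c i‖ ^ 2 := by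
    have : inner ℂ (A u) (A u) = ((∑ i : Fin (k + 1), t i ^ 2 * ‖c i‖ ^ 2 : ℝ) : ℂ) := by
      conv_lhs => rw [hAu, sum_inner]
      push_cast
      refine Finset.sum_congr rfl fun i _ => ?_
      rw [inner_smul_left, ← hAu, (heig i).inner_apply hA (hmem i) u, hinner]
      push_cast
      rw [mul_left_comm, Complex.conj_mul']
    rw [← inner_self_eq_norm_sq (𝕜 := ℂ), this]
    exact Complex.ofReal_re _
  -- On the span of `e 0, …, e k` the operator is diagonal and all its singular values are at most
  -- `t k`.
  have h3 : ‖A u‖ ^ 2 ≤ (t k * ‖(u : H)‖) ^ 2 := by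
    rw [h2, mul_pow, h1, Finset.mul_sum]
    refine Finset.sum_le_sum fun i _ => ?_
    gcongr
    · exact ht _
    · exact hmono (Nat.lt_succ_iff.1 i.2)
  have h4 : ‖A u‖ ≤ t k * ‖(u : H)‖ :=
    (abs_le_of_sq_le_sq' h3 (mul_nonneg (ht k) (norm_nonneg _))).2
  have hupos : 0 < ‖(u : H)‖ := by
    have : 0 < ‖(u : H)‖ ^ 2 := by
      rw [h1]
      obtain ⟨i, hi⟩ := Function.ne_iff.1 hc0
      exact Finset.sum_pos' (fun _ _ => by positivity)
        ⟨i, Finset.mem_univ _, by have := norm_pos_iff.2 hi; positivity⟩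
    exact (norm_nonneg _).lt_of_ne fun h0 => by simp [← h0] at this
  exact le_of_mul_le_mul_right ((hL u hLu).trans h4) hupos

theorem IsSingularValueSeq.le_of_coercive {A : H →ₗ.[ℂ] H} (hA : Dense (A.domain : Set H))
    {t : ℕ → ℝ} (h : IsSingularValueSeq A t) {ι : Type*} [Fintype ι]
    (L : A.domain →ₗ[ℂ] (ι → ℂ)) {κ : ℝ}
    (hL : ∀ u : A.domain, L u = 0 → κ * ‖(u : H)‖ ≤ ‖A u‖) {k : ℕ} (hk : Fintype.card ι ≤ k) :
    κ ≤ t k := by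
  obtain ⟨e, he⟩ := h.basis
  exact SmallSV.le_of_coercive hA e.orthonormal he h.nonneg h.mono L hL hk

/-- An operator that is small on subspaces of finite codimension is compact. -/
theorem isCompactOperator_of_finite_codim {V : Type*} [NormedAddCommGroup V]
    [InnerProductSpace ℂ V] [CompleteSpace V] (J : V →L[ℂ] H)
    (hJ : ∀ ε : ℝ, 0 < ε → ∃ (ι : Type) (_ : Fintype ι) (L : V →ₗ[ℂ] (ι → ℂ)),
      ∀ v, L v = 0 → ‖J v‖ ≤ ε * ‖v‖) : IsCompactOperator J := by
  have key : ∀ ε : ℝ, 0 < ε → ∃ K : V →L[ℂ] H, IsCompactOperator K ∧ ‖J - K‖ ≤ ε := by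
    intro ε hε
    obtain ⟨ι, _, L, hL⟩ := hJ ε hε
    -- `L` need not be continuous, so its kernel is replaced by the closure, to which the estimate
    -- extends by continuity of `J`.
    let W : Submodule ℂ V := (LinearMap.ker L).topologicalClosure
    have hWc : IsClosed (W : Set V) := Submodule.isClosed_topologicalClosure _
    have : CompleteSpace W := hWc.completeSpace_coe
    have hW : ∀ v ∈ W, ‖J v‖ ≤ ε * ‖v‖ := by
      intro v hv
      have hcl : IsClosed {v : V | ‖J v‖ ≤ ε * ‖v‖} :=
        isClosed_le (by fun_prop) (by fun_prop)
      exact closure_minimal (fun v hv => hL v hv) hcl hv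
    -- `L` is injective on `Wᗮ`, because its kernel lies in `W`. Hence `J` composed with the
    -- projection to `Wᗮ` has finite rank and is within `ε` of `J`.
    have hfin : FiniteDimensional ℂ Wᗮ := by
      refine FiniteDimensional.of_injective (L ∘ₗ Wᗮ.subtype) ?_
      rw [← LinearMap.ker_eq_bot, LinearMap.ker_eq_bot']
      intro x hx
      have h1 : (x : V) ∈ W := Submodule.le_topologicalClosure _ hx
      have h2 := (Submodule.mem_orthogonal _ _).1 x.2 _ h1
      exact Subtype.ext (inner_self_eq_zero.1 h2)
    refine ⟨J ∘L Wᗮ.subtypeL ∘L Wᗮ.orthogonalProjectionOnto, ?_, ?_⟩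
    · have : IsCompactOperator Wᗮ.orthogonalProjectionOnto :=
        isCompactOperator_of_locallyCompactSpace_dom _
      exact this.clm_comp (J ∘L Wᗮ.subtypeL)
    · refine ContinuousLinearMap.opNorm_le_bound _ hε.le fun v => ?_
      have h1 : (J - J ∘L Wᗮ.subtypeL ∘L Wᗮ.orthogonalProjectionOnto) v
          = J (W.starProjection v) := by
        simp only [sub_apply, ContinuousLinearMap.comp_apply]
        rw [← map_sub]
        congr 1
        have := W.starProjection_add_starProjection_orthogonal v
        rw [sub_eq_iff_eq_add]
        exact this.symm
      rw [h1]
      refine (hW _ (Submodule.starProjection_apply_mem W v)).trans ?_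
      gcongr
      exact Submodule.norm_starProjection_apply_le W v
  choose K hK1 hK2 using fun n : ℕ => key (1 / (n + 1 : ℝ)) (by positivity)
  refine isCompactOperator_of_tendsto (l := atTop) (F := K) ?_ (Eventually.of_forall hK1)
  rw [tendsto_iff_norm_sub_tendsto_zero]
  refine squeeze_zero (fun _ => norm_nonneg _) (fun n => ?_)
    tendsto_one_div_add_atTop_nhds_zero_nat
  rw [norm_sub_rev]
  exact hK2 n

end Abstract

/-! ### Spectral theory of compact positive operators -/

section Compact

variable {H : Type*} [NormedAddCommGroup H] [InnerProductSpace ℂ H] [CompleteSpace H]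

/-- A positive definite compact symmetric operator attains its norm on a closed invariant
subspace at an eigenvector. -/
theorem exists_top_eigenvector {S : H →L[ℂ] H} (hS : IsCompactOperator S) (hsymm : S.IsSymmetric)
    (hpos : ∀ x, x ≠ 0 → 0 < (inner ℂ x (S x)).re) {W : Submodule ℂ H} (hWc : IsClosed (W : Set H))
    (hinv : ∀ x ∈ W, S x ∈ W) (hW : W ≠ ⊥) :
    ∃ e ∈ W, ‖e‖ = 1 ∧ ∃ μ : ℝ, 0 < μ ∧ S e = (μ : ℂ) • e ∧
      ∀ x ∈ W, (inner ℂ x (S x)).re ≤ μ * ‖x‖ ^ 2 := by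
  have : CompleteSpace W := hWc.completeSpace_coe
  have : Nontrivial W := Submodule.nontrivial_iff_ne_bot.2 hW
  let T : W →L[ℂ] W := S.restrict hinv
  have hTapp : ∀ x : W, ((T x : W) : H) = S x := fun _ => rfl
  have hT : IsCompactOperator T := hS.restrict' hinv
  have hTs : T.IsSymmetric := hsymm.restrict_invariant hinv
  -- For a self-adjoint operator the spectral radius is the norm; by compactness a nonzero spectral
  -- value of that modulus is an eigenvalue, and positivity makes it positive.
  obtain ⟨z, hz, hzn⟩ := spectrum.exists_nnnorm_eq_spectralRadius T
  rw [T.spectralRadius_eq_nnnorm hTs.isSelfAdjoint] at hzn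
  have hzn' : ‖z‖ = ‖T‖ := congrArg NNReal.toReal (ENNReal.coe_injective hzn)
  have hz0 : z ≠ 0 := by
    rintro rfl
    have hT0 : T = 0 := by
      rw [norm_zero] at hzn'
      exact (ContinuousLinearMap.opNorm_zero_iff T).1 hzn'.symm
    obtain ⟨x, hx⟩ := exists_ne (0 : W)
    have h1 := hpos x (by simpa using hx)
    rw [← hTapp, hT0] at h1
    simp at h1
  have hev : Module.End.HasEigenvalue (T : Module.End ℂ W) z :=
    (hT.hasEigenvalue_iff_mem_spectrum hz0).2 hz
  obtain ⟨v, hv⟩ := hev.exists_hasEigenvector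
  have hv0 : v ≠ 0 := hv.2
  have hTv : T v = z • v := hv.apply_eq_smul
  have hconj := hTs.conj_eigenvalue_eq_self hev
  obtain ⟨μ, rfl⟩ : ∃ μ : ℝ, z = (μ : ℂ) := Complex.conj_eq_iff_real.1 hconj
  have hSv : S (v : H) = (μ : ℂ) • (v : H) := by
    rw [← hTapp, hTv]; rfl
  have hvH : (v : H) ≠ 0 := by simpa using hv0
  have hvn : 0 < ‖(v : H)‖ := norm_pos_iff.2 hvH
  have hμ : 0 < μ := by
    have h1 := hpos v hvH
    rw [hSv, inner_smul_right, Complex.re_ofReal_mul] at h1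
    have h2 : (inner ℂ (v : H) (v : H)).re = ‖(v : H)‖ ^ 2 := inner_self_eq_norm_sq (𝕜 := ℂ) _
    rw [h2] at h1
    exact pos_of_mul_pos_left h1 (by positivity)
  refine ⟨((‖(v : H)‖⁻¹ : ℝ) : ℂ) • (v : H), W.smul_mem _ v.2, ?_, μ, hμ, ?_, ?_⟩
  · rw [norm_smul, Complex.norm_real, norm_inv, norm_norm, inv_mul_cancel₀ hvn.ne']
  · rw [map_smul, hSv, smul_comm]
  · intro x hx
    have h1 : ‖S x‖ ≤ μ * ‖x‖ := by
      have := T.le_opNorm ⟨x, hx⟩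
      rw [← hzn', Complex.norm_real, Real.norm_of_nonneg hμ.le] at this
      exact this
    calc (inner ℂ x (S x)).re ≤ ‖inner ℂ x (S x)‖ := Complex.re_le_norm _
      _ ≤ ‖x‖ * ‖S x‖ := norm_inner_le_norm _ _
      _ ≤ ‖x‖ * (μ * ‖x‖) := by gcongr
      _ = μ * ‖x‖ ^ 2 := by ring

/-- Eigenvectors of a positive definite compact symmetric operator, with antitone eigenvalues,
produced by successive maximization. -/
theorem exists_eigenvector_seq {S : H →L[ℂ] H} (hS : IsCompactOperator S) (hsymm : S.IsSymmetric)
    (hpos : ∀ x, x ≠ 0 → 0 < (inner ℂ x (S x)).re) (hH : ¬ FiniteDimensional ℂ H) :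
    ∃ (e : ℕ → H) (μ : ℕ → ℝ), Orthonormal ℂ e ∧ Antitone μ ∧ (∀ n, 0 < μ n) ∧
      (∀ n, S (e n) = (μ n : ℂ) • e n) ∧
      ∀ x, (∀ n, inner ℂ (e n) x = 0) → ∀ n, (inner ℂ x (S x)).re ≤ μ n * ‖x‖ ^ 2 := by
  let St := {F : Submodule ℂ H // FiniteDimensional ℂ F ∧ ∀ x ∈ F, S x ∈ F}
  have step : ∀ F : St, ∃ (e : H) (μ : ℝ), e ∈ F.1ᗮ ∧ ‖e‖ = 1 ∧ 0 < μ ∧ S e = (μ : ℂ) • e ∧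
      ∀ x ∈ F.1ᗮ, (inner ℂ x (S x)).re ≤ μ * ‖x‖ ^ 2 := by
    rintro ⟨F, hF, hFi⟩
    -- The maximization never stops, since `H` is infinite-dimensional and `F` is not.
    have hne : Fᗮ ≠ ⊥ := by
      intro h
      have : F = ⊤ := (Submodule.orthogonal_eq_bot_iff (K := F)).1 h
      exact hH (Module.finite_def.2 (by rw [← this]; exact Module.Finite.iff_fg.1 hF))
    have hFi' : ∀ x ∈ Fᗮ, S x ∈ Fᗮ := by
      intro x hx
      rw [Submodule.mem_orthogonal] at hx ⊢
      intro y hy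
      have h1 : inner ℂ (S y) x = inner ℂ y (S x) := hsymm y x
      rw [← h1]
      exact hx _ (hFi y hy)
    obtain ⟨e, he, hn, μ, h1, h2, h3⟩ :=
      exists_top_eigenvector hS hsymm hpos (Submodule.isClosed_orthogonal F) hFi' hne
    exact ⟨e, μ, he, hn, h1, h2, h3⟩
  choose E M hE hn hM hSE hmax using step
  let next : St → St := fun F => ⟨F.1 ⊔ Submodule.span ℂ {E F}, by
    have := F.2.1
    refine ⟨inferInstance, fun x hx => ?_⟩
    obtain ⟨y, hy, z, hz, rfl⟩ := Submodule.mem_sup.1 hx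
    obtain ⟨c, rfl⟩ := Submodule.mem_span_singleton.1 hz
    rw [map_add, map_smul, hSE]
    exact Submodule.add_mem_sup (F.2.2 y hy) (Submodule.smul_mem _ _ (Submodule.smul_mem _ _
      (Submodule.mem_span_singleton_self _)))⟩
  let F : ℕ → St := fun n => Nat.rec ⟨⊥, inferInstance, by simp⟩ (fun _ G => next G) n
  have hF : ∀ n, (F (n + 1)).1 = (F n).1 ⊔ Submodule.span ℂ {E (F n)} := fun n => rfl
  have hF0 : (F 0).1 = ⊥ := rfl
  have hmono : Monotone fun n => (F n).1 :=
    monotone_nat_of_le_succ fun n => by rw [hF]; exact le_sup_left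
  have hmem : ∀ i j, i < j → E (F i) ∈ (F j).1 := fun i j hij =>
    hmono (Nat.succ_le_of_lt hij) (by
      simp only [Nat.succ_eq_add_one, hF]
      exact Submodule.mem_sup_right (Submodule.mem_span_singleton_self _))
  have hlt : ∀ i j, i < j → inner ℂ (E (F i)) (E (F j)) = 0 := fun i j hij =>
    (Submodule.mem_orthogonal _ _).1 (hE (F j)) _ (hmem i j hij)
  have horth : Orthonormal ℂ fun n => E (F n) := by
    refine ⟨fun n => hn _, fun i j hij => ?_⟩
    rcases lt_or_gt_of_ne hij with h | h
    · exact hlt i j h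
    · exact inner_eq_zero_symm.1 (hlt j i h)
  refine ⟨fun n => E (F n), fun n => M (F n), horth, ?_, fun n => hM _, fun n => hSE _, ?_⟩
  · refine antitone_nat_of_succ_le fun n => ?_
    -- The next eigenvector is already a competitor in the `n`-th maximization, hence its eigenvalue
    -- is no larger.
    have h1 := hmax (F n) (E (F (n + 1)))
      (Submodule.orthogonal_le (hmono (Nat.le_succ n)) (hE (F (n + 1))))
    have h2 : (inner ℂ (E (F (n + 1))) (E (F (n + 1)))).re = ‖E (F (n + 1))‖ ^ 2 :=
      inner_self_eq_norm_sq (𝕜 := ℂ) _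
    rw [hSE, inner_smul_right, Complex.re_ofReal_mul, h2, hn] at h1
    simpa using h1
  · intro x hx n
    refine hmax (F n) x ?_
    induction n with
    | zero => rw [hF0]; simp
    | succ n ih =>
      rw [hF, ← Submodule.inf_orthogonal]
      refine ⟨ih, ?_⟩
      exact Submodule.mem_orthogonal_singleton_iff_inner_right.2 (hx n)

end Compact

/-! ### Existence of the singular values -/

section Abstract

variable {H : Type*} [NormedAddCommGroup H] [InnerProductSpace ℂ H]

/-- The graph of `A` as a subspace of the Hilbert space `H ⊕ H`. -/
def hilbertGraph (A : H →ₗ.[ℂ] H) : Submodule ℂ (WithLp 2 (H × H)) :=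
  A.graph.comap (WithLp.linearEquiv 2 ℂ (H × H)).toLinearMap

theorem mem_hilbertGraph {A : H →ₗ.[ℂ] H} {v : WithLp 2 (H × H)} :
    v ∈ hilbertGraph A ↔ ∃ x : A.domain, (x : H) = v.fst ∧ A x = v.snd := by
  rw [hilbertGraph, Submodule.mem_comap, LinearPMap.mem_graph_iff]
  rfl

theorem isClosed_hilbertGraph {A : H →ₗ.[ℂ] H} (hA : A.IsClosed) :
    IsClosed (hilbertGraph A : Set (WithLp 2 (H × H))) :=
  IsClosed.preimage (WithLp.prod_continuous_ofLp 2 H H) hA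

/-- A closed densely defined operator that is arbitrarily coercive on subspaces of finite
codimension has a sequence of singular values. -/
theorem exists_isSingularValueSeq [CompleteSpace H] (hH : ¬ FiniteDimensional ℂ H) {A : H →ₗ.[ℂ] H}
    (hA : Dense (A.domain : Set H)) (hcl : A.IsClosed)
    (hco : ∀ κ : ℝ, ∃ (ι : Type) (_ : Fintype ι) (L : A.domain →ₗ[ℂ] (ι → ℂ)),
      ∀ u : A.domain, L u = 0 → κ * ‖(u : H)‖ ≤ ‖A u‖) :
    ∃ t : ℕ → ℝ, IsSingularValueSeq A t := by
  let V := hilbertGraph A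
  have : CompleteSpace V := (isClosed_hilbertGraph hcl).completeSpace_coe
  let J : V →L[ℂ] H := (WithLp.fstL 2 ℂ H H) ∘L V.subtypeL
  let dom : V →ₗ[ℂ] A.domain := LinearMap.codRestrict A.domain J.toLinearMap fun v => by
    obtain ⟨x, hx, -⟩ := mem_hilbertGraph.1 v.2
    change (v : WithLp 2 (H × H)).fst ∈ A.domain
    rw [← hx]; exact x.2
  have hdom : ∀ v : V, ((dom v : A.domain) : H) = J v := fun _ => rfl
  have hAdom : ∀ v : V, A (dom v) = (v : WithLp 2 (H × H)).snd := fun v => by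
    obtain ⟨x, hx, hAx⟩ := mem_hilbertGraph.1 v.2
    rw [← hAx]
    congr 1
    exact Subtype.ext hx.symm
  have hnorm : ∀ v : V, ‖A (dom v)‖ ≤ ‖v‖ := fun v => by
    rw [hAdom]
    exact WithLp.norm_snd_le _ (v : WithLp 2 (H × H))
  have hJc : IsCompactOperator J := by
    refine isCompactOperator_of_finite_codim J fun ε hε => ?_
    obtain ⟨ι, hι, L, hL⟩ := hco ε⁻¹
    refine ⟨ι, hι, L ∘ₗ dom, fun v hv => ?_⟩
    have h1 := (hL (dom v) hv).trans (hnorm v)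
    rwa [hdom, inv_mul_le_iff₀ hε] at h1
  have hmk : ∀ y : A.domain, ∃ v : V, dom v = y := fun y =>
    ⟨⟨WithLp.toLp 2 ((y : H), A y), mem_hilbertGraph.2 ⟨y, rfl, rfl⟩⟩, rfl⟩
  have hinner : ∀ (x : H) (v : V), inner ℂ (J.adjoint x) v = inner ℂ x (J v) := fun x v =>
    ContinuousLinearMap.adjoint_inner_left J v x
  have hVinner : ∀ v v' : V, inner ℂ v v' =
      inner ℂ (J v) (J v') + inner ℂ (A (dom v)) (A (dom v')) := fun v v' => by
    rw [hAdom, hAdom]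
    exact WithLp.prod_inner_apply _ _
  -- By `hVinner`, `J.adjoint x` is the graph point over the `z` with `⟨z, y⟩ + ⟨A z, A y⟩ = ⟨x, y⟩`
  -- for all `y` in the domain. So `S` is `(1 + A* A)⁻¹`.
  let S : H →L[ℂ] H := J ∘L J.adjoint
  have hSin : ∀ x y, inner ℂ x (S y) = inner ℂ (J.adjoint x) (J.adjoint y) := fun x y =>
    (hinner x _).symm
  have hSc : IsCompactOperator S := hJc.comp_clm J.adjoint
  have hsymm : S.IsSymmetric := (ContinuousLinearMap.isPositive_self_comp_adjoint J).isSymmetric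
  have hpos : ∀ x, x ≠ 0 → 0 < (inner ℂ x (S x)).re := by
    intro x hx
    rw [hSin]
    have h2 : (inner ℂ (J.adjoint x) (J.adjoint x)).re = ‖J.adjoint x‖ ^ 2 :=
      inner_self_eq_norm_sq (𝕜 := ℂ) (E := V) _
    rw [h2]
    have : J.adjoint x ≠ 0 := by
      intro h0
      apply hx
      refine hA.eq_zero_of_inner_left ℂ fun y hy => ?_
      obtain ⟨v, hv⟩ := hmk ⟨y, hy⟩
      have hy' : y = J v := by rw [← hdom, hv]
      rw [hy', ← hinner, h0, inner_zero_left]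
    positivity
  obtain ⟨e, μ, he, hanti, hμ, hSe, hmax⟩ := exists_eigenvector_seq hSc hsymm hpos hH
  -- This is `μ (1 + A* A) e = e` in weak form, available before `A e` is known to lie in the domain
  -- of the adjoint.
  have hform : ∀ n, ∃ hn : e n ∈ A.domain, ∀ y : A.domain,
      (μ n : ℂ) * inner ℂ (e n) (y : H) + (μ n : ℂ) * inner ℂ (A ⟨e n, hn⟩) (A y)
        = inner ℂ (e n) (y : H) := by
    intro n
    set v := J.adjoint (e n)
    have hJv : J v = (μ n : ℂ) • e n := hSe n
    have hne : (μ n : ℂ) ≠ 0 := by exact_mod_cast (hμ n).ne'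
    have hen : e n = (μ n : ℂ)⁻¹ • J v := by rw [hJv, inv_smul_smul₀ hne]
    have hmem : e n ∈ A.domain := by
      rw [hen]; exact A.domain.smul_mem _ (dom v).2
    refine ⟨hmem, fun y => ?_⟩
    have hdv : dom v = (μ n : ℂ) • (⟨e n, hmem⟩ : A.domain) := Subtype.ext hJv
    obtain ⟨v', rfl⟩ := hmk y
    have h1 := hinner (e n) v'
    rw [hVinner, hJv, hdv, LinearPMap.map_smul, inner_smul_left, inner_smul_left,
      Complex.conj_ofReal] at h1
    rw [hdom]
    exact h1
  have hl : ∀ n, 0 ≤ (μ n)⁻¹ - 1 := by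
    intro n
    obtain ⟨hn, h⟩ := hform n
    have h1 := congrArg Complex.re (h ⟨e n, hn⟩)
    have h2 : (inner ℂ (e n) (e n)).re = ‖e n‖ ^ 2 := inner_self_eq_norm_sq (𝕜 := ℂ) _
    have h3 : (inner ℂ (A ⟨e n, hn⟩) (A ⟨e n, hn⟩)).re = ‖A ⟨e n, hn⟩‖ ^ 2 :=
      inner_self_eq_norm_sq (𝕜 := ℂ) _
    rw [Complex.add_re, Complex.re_ofReal_mul, Complex.re_ofReal_mul, h2, h3, he.1] at h1
    rw [sub_nonneg, one_le_inv₀ (hμ n)]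
    have := mul_nonneg (hμ n).le (sq_nonneg ‖A ⟨e n, hn⟩‖)
    linarith
  -- From `μ (1 + t²) = 1`; `hl` makes the square root exact.
  let t : ℕ → ℝ := fun n => Real.sqrt ((μ n)⁻¹ - 1)
  have ht2 : ∀ n, t n ^ 2 = (μ n)⁻¹ - 1 := fun n => Real.sq_sqrt (hl n)
  have ht0 : ∀ n, 0 ≤ t n := fun n => Real.sqrt_nonneg _
  have hmono : Monotone t := fun i j hij =>
    Real.sqrt_le_sqrt (sub_le_sub_right (inv_anti₀ (hμ j) (hanti hij)) 1)
  have heig : ∀ n, IsEigenpair A (t n ^ 2) (e n) := by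
    intro n
    obtain ⟨hn, h⟩ := hform n
    have hne : (μ n : ℂ) ≠ 0 := by exact_mod_cast (hμ n).ne'
    have key : ∀ y : A.domain,
        inner ℂ (((t n ^ 2 : ℝ) : ℂ) • e n) (y : H) = inner ℂ (A ⟨e n, hn⟩) (A y) := by
      intro y
      rw [inner_smul_left, Complex.conj_ofReal, ht2]
      push_cast
      field_simp
      linear_combination - h y
    have hmem : A ⟨e n, hn⟩ ∈ A.adjoint.domain := A.mem_adjoint_domain_of_exists _ ⟨_, key⟩
    exact ⟨hn, hmem, A.adjoint_apply_eq hA ⟨_, hmem⟩ key⟩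
  have htend : Tendsto t atTop atTop := by
    refine tendsto_atTop_atTop.2 fun κ => ?_
    obtain ⟨ι, hι, L, hL⟩ := hco κ
    exact ⟨Fintype.card ι, fun k hk => le_of_coercive hA he heig ht0 hmono L hL hk⟩
  have hμ0 : Tendsto μ atTop (nhds 0) := by
    have h1 : Tendsto (fun n => (t n ^ 2 + 1)⁻¹) atTop (nhds 0) :=
      tendsto_inv_atTop_zero.comp
        (tendsto_atTop_add_const_right _ _ ((tendsto_pow_atTop two_ne_zero).comp htend))
    refine h1.congr fun n => ?_
    rw [ht2]; simp
  have hbot : (Submodule.span ℂ (Set.range e))ᗮ = ⊥ := by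
    rw [Submodule.eq_bot_iff]
    intro x hx
    by_contra hx0
    have h1 : ∀ n, inner ℂ (e n) x = 0 := fun n =>
      (Submodule.mem_orthogonal _ _).1 hx _ (Submodule.subset_span ⟨n, rfl⟩)
    -- A vector orthogonal to all `e n` obeys every maximization bound, and these tend to zero,
    -- contradicting positivity of `S`.
    have h2 : (inner ℂ x (S x)).re ≤ 0 * ‖x‖ ^ 2 :=
      ge_of_tendsto' (hμ0.mul_const _) (hmax x h1)
    have := hpos x hx0
    linarith
  refine ⟨t, ht0, hmono, htend, HilbertBasis.mkOfOrthogonalEqBot he hbot, fun k => ?_⟩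
  rw [HilbertBasis.coe_mkOfOrthogonalEqBot]
  exact heig k

end Abstract

/-! ### Primitives of locally integrable functions -/

/-- `U` is locally absolutely continuous on `ℝ` with derivative `G`. -/
def IsPrimitive (U G : ℝ → ℂ) : Prop :=
  (∀ a b, IntervalIntegrable G volume a b) ∧ ∀ a b, U b - U a = ∫ x in a..b, G x

namespace IsPrimitive

variable {U V G K : ℝ → ℂ}

theorem eq_add (h : IsPrimitive U G) (a : ℝ) : U = fun x => U a + ∫ y in a..x, G y :=
  funext fun x => by rw [← h.2 a x]; ring

theorem integral (hG : ∀ a b, IntervalIntegrable G volume a b) :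
    IsPrimitive (fun x => ∫ y in (0 : ℝ)..x, G y) G :=
  ⟨hG, fun a b => intervalIntegral.integral_interval_sub_left (hG 0 b) (hG 0 a)⟩

theorem continuous (h : IsPrimitive U G) : Continuous U := by
  rw [h.eq_add 0]
  exact continuous_const.add (intervalIntegral.continuous_primitive h.1 0)

theorem conj (h : IsPrimitive U G) :
    IsPrimitive (fun x => starRingEnd ℂ (U x)) (fun x => starRingEnd ℂ (G x)) := by
  refine ⟨fun a b => ?_, fun a b => ?_⟩
  · have := h.1 a b
    exact ⟨(Complex.conjCLE : ℂ →L[ℝ] ℂ).integrable_comp this.1,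
      (Complex.conjCLE : ℂ →L[ℝ] ℂ).integrable_comp this.2⟩
  · have := (Complex.conjCLE : ℂ →L[ℝ] ℂ).intervalIntegral_comp_comm (h.1 a b)
    rw [← h.2] at this
    simpa using this.symm

theorem of_hasDerivAt {f f' : ℝ → ℂ} (h : ∀ x, HasDerivAt f (f' x) x) (hf' : Continuous f') :
    IsPrimitive f f' :=
  ⟨fun a b => hf'.intervalIntegrable a b, fun a b =>
    (intervalIntegral.integral_eq_sub_of_hasDerivAt (fun x _ => h x)
      (hf'.intervalIntegrable a b)).symm⟩

theorem absolutelyContinuousOnInterval (h : IsPrimitive U G) (a b : ℝ) :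
    AbsolutelyContinuousOnInterval U a b := by
  have hconst : ∀ c : ℂ, AbsolutelyContinuousOnInterval (fun _ : ℝ => c) a b := fun c =>
    ((LipschitzWith.const c).lipschitzOnWith (s := uIcc a b)).absolutelyContinuousOnInterval
  have hre : IntervalIntegrable (fun x => (G x).re) volume a b :=
    ⟨Complex.reCLM.integrable_comp (h.1 a b).1, Complex.reCLM.integrable_comp (h.1 a b).2⟩
  have him : IntervalIntegrable (fun x => (G x).im) volume a b :=
    ⟨Complex.imCLM.integrable_comp (h.1 a b).1, Complex.imCLM.integrable_comp (h.1 a b).2⟩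
  have h1 := (hre.absolutelyContinuousOnInterval_intervalIntegral
    (c := a) left_mem_uIcc).fun_smul (hconst 1)
  have h2 := (him.absolutelyContinuousOnInterval_intervalIntegral
    (c := a) left_mem_uIcc).fun_smul (hconst Complex.I)
  have h3 := (h1.fun_add h2).fun_add (hconst (U a))
  suffices hU : U = fun x => (∫ v in a..x, (G v).re) • (1 : ℂ) +
      (∫ v in a..x, (G v).im) • Complex.I + U a by
    rw [hU]; exact h3
  funext x
  have e1 := Complex.reCLM.intervalIntegral_comp_comm (h.1 a x)
  have e2 := Complex.imCLM.intervalIntegral_comp_comm (h.1 a x)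
  rw [← h.2] at e1 e2
  simp only [Complex.reCLM_apply, Complex.imCLM_apply] at e1 e2
  rw [e1, e2]
  simp only [Complex.real_smul, mul_one]
  rw [Complex.re_add_im]
  ring

theorem ae_hasDerivAt (h : IsPrimitive U G) : ∀ᵐ x, HasDerivAt U (G x) x := by
  have hl : LocallyIntegrable G volume := by
    rw [locallyIntegrable_iff]
    intro k hk
    obtain ⟨R, hR⟩ := hk.isBounded.subset_closedBall 0
    rw [Real.closedBall_eq_Icc] at hR
    have h1 := (h.1 (0 - |R|) (0 + |R|))
    rw [intervalIntegrable_iff_integrableOn_Icc_of_le (by linarith [abs_nonneg R])] at h1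
    exact h1.mono_set (hR.trans (Icc_subset_Icc (by linarith [le_abs_self R])
      (by linarith [le_abs_self R])))
  filter_upwards [LocallyIntegrable.ae_hasDerivAt_integral hl] with x hx
  rw [h.eq_add 0]
  simpa using (hx 0).const_add (U 0)

/-- The product minus its candidate primitive is absolutely continuous with derivative zero almost
everywhere, hence constant. Neither factor need be differentiable everywhere. -/
theorem mul (h : IsPrimitive U G) (h' : IsPrimitive V K) :
    IsPrimitive (fun x => U x * V x) (fun x => G x * V x + U x * K x) := by
  have hintg : ∀ a b, IntervalIntegrable (fun x => G x * V x + U x * K x) volume a b :=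
    fun a b => ((h.1 a b).mul_continuousOn h'.continuous.continuousOn).add
      ((h'.1 a b).continuousOn_mul h.continuous.continuousOn)
  refine ⟨hintg, fun a b => ?_⟩
  have hP := IsPrimitive.integral hintg
  have hac : AbsolutelyContinuousOnInterval
      (fun x => U x * V x - ∫ y in (0 : ℝ)..x, (G y * V y + U y * K y)) a b :=
    ((h.absolutelyContinuousOnInterval a b).fun_smul
      (h'.absolutelyContinuousOnInterval a b)).fun_sub (hP.absolutelyContinuousOnInterval a b)
  have hd : ∀ᵐ x, x ∈ uIcc a b → HasDerivAt
      (fun x => U x * V x - ∫ y in (0 : ℝ)..x, (G y * V y + U y * K y)) 0 x := by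
    filter_upwards [h.ae_hasDerivAt, h'.ae_hasDerivAt, hP.ae_hasDerivAt] with x h1 h2 h3 _
    exact ((h1.fun_mul h2).fun_sub h3).congr_deriv (sub_self _)
  obtain ⟨C, hC⟩ := hac.const_of_ae_hasDerivAt_zero hd
  have e1 := hC a left_mem_uIcc
  have e2 := hC b right_mem_uIcc
  rw [← hP.2 a b]
  linear_combination e2 - e1

end IsPrimitive

/-! ### Energy estimates for `h U' + m U` -/

/-- The product rule applied to `w · U · conj U`. All energy estimates below start from this
identity. -/
theorem normSq_mul_sub_eq {U G : ℝ → ℂ} (hU : IsPrimitive U G) {w w' : ℝ → ℝ}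
    (hw : ∀ x, HasDerivAt w (w' x) x) (hw' : Continuous w') (p q : ℝ) :
    w q * ‖U q‖ ^ 2 - w p * ‖U p‖ ^ 2 =
      ∫ x in p..q, (w' x * ‖U x‖ ^ 2 + 2 * w x * (G x * starRingEnd ℂ (U x)).re) := by
  have hwP : IsPrimitive (fun x => (w x : ℂ)) (fun x => (w' x : ℂ)) :=
    IsPrimitive.of_hasDerivAt (fun x => (hw x).ofReal_comp) (by fun_prop)
  have hP := hwP.mul (hU.mul hU.conj)
  have h1 := hP.2 p q
  have h2 := Complex.reCLM.intervalIntegral_comp_comm (hP.1 p q)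
  rw [← h1] at h2
  simp only [Complex.mul_conj', Complex.reCLM_apply, Complex.sub_re] at h2
  norm_cast at h2
  rw [← h2]
  refine intervalIntegral.integral_congr fun x _ => ?_
  simp only [Complex.add_re, Complex.re_ofReal_mul, Complex.ofReal_re]
  have e : (U x * starRingEnd ℂ (G x)).re = (G x * starRingEnd ℂ (U x)).re := by
    simp only [Complex.mul_re, Complex.conj_re, Complex.conj_im]; ring
  rw [e]
  ring

section Energy

variable {U G : ℝ → ℂ} {m : ℝ → ℝ}

theorem IsPrimitive.intervalIntegrable_op (hU : IsPrimitive U G) (hm : Continuous m) (h p q : ℝ) :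
    IntervalIntegrable (fun x => (h : ℂ) * G x + (m x : ℂ) * U x) volume p q := by
  have := hU.continuous
  exact ((hU.1 p q).const_mul _).add
    (Continuous.intervalIntegrable (by fun_prop) p q)

theorem IsPrimitive.intervalIntegrable_norm_mul (hU : IsPrimitive U G) (hm : Continuous m)
    (h p q : ℝ) :
    IntervalIntegrable (fun x => ‖(h : ℂ) * G x + (m x : ℂ) * U x‖ * ‖U x‖) volume p q :=
  (hU.intervalIntegrable_op hm h p q).norm.mul_continuousOn hU.continuous.norm.continuousOn

/-- The multiplier method: pairing `h U' + m U` with `w U`. -/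
theorem IsPrimitive.multiplier_estimate (hU : IsPrimitive U G) (hm : Continuous m)
    {h κ N p q : ℝ} (hpq : p ≤ q) {w w' : ℝ → ℝ} (hw : ∀ x, HasDerivAt w (w' x) x)
    (hw' : Continuous w') (hN : ∀ x ∈ Icc p q, |w x| ≤ N)
    (hκ : ∀ x ∈ Icc p q, κ ≤ m x * w x - h / 2 * w' x) :
    κ * ∫ x in p..q, ‖U x‖ ^ 2 ≤
      N * (∫ x in p..q, ‖(h : ℂ) * G x + (m x : ℂ) * U x‖ * ‖U x‖) +
        h / 2 * (w p * ‖U p‖ ^ 2 - w q * ‖U q‖ ^ 2) := by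
  have hUc := hU.continuous
  have hwc : Continuous w := continuous_iff_continuousAt.2 fun x => (hw x).continuousAt
  have hF := hU.intervalIntegrable_norm_mul hm h p q
  have hRe : IntervalIntegrable (fun x => (G x * starRingEnd ℂ (U x)).re) volume p q := by
    have := (hU.1 p q).mul_continuousOn hU.conj.continuous.continuousOn
    exact ⟨Complex.reCLM.integrable_comp this.1, Complex.reCLM.integrable_comp this.2⟩
  have hE : IntervalIntegrable
      (fun x => w' x * ‖U x‖ ^ 2 + 2 * w x * (G x * starRingEnd ℂ (U x)).re) volume p q :=
    (Continuous.intervalIntegrable (by fun_prop) p q).add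
      (hRe.continuousOn_mul (g := fun x => 2 * w x) (by fun_prop))
  -- Pointwise, the pairing is `h Re(U' conj U) + m |U|²`. Multiplying by `w` and subtracting the
  -- energy density times `h / 2` leaves `(m w - (h / 2) w') |U|²`, to which `hκ` applies.
  have key : ∫ x in p..q, κ * ‖U x‖ ^ 2 ≤
      ∫ x in p..q, (N * (‖(h : ℂ) * G x + (m x : ℂ) * U x‖ * ‖U x‖) -
        h / 2 * (w' x * ‖U x‖ ^ 2 + 2 * w x * (G x * starRingEnd ℂ (U x)).re)) := by
    refine intervalIntegral.integral_mono_on hpq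
      (Continuous.intervalIntegrable (by fun_prop) p q) ((hF.const_mul _).sub (hE.const_mul _))
      fun x hx => ?_
    have h1 : (((h : ℂ) * G x + (m x : ℂ) * U x) * starRingEnd ℂ (U x)).re =
        h * (G x * starRingEnd ℂ (U x)).re + m x * ‖U x‖ ^ 2 := by
      rw [add_mul, mul_assoc, mul_assoc, Complex.mul_conj', Complex.add_re, Complex.re_ofReal_mul,
        Complex.re_ofReal_mul]
      norm_cast
    have h2 : |(((h : ℂ) * G x + (m x : ℂ) * U x) * starRingEnd ℂ (U x)).re| ≤
        ‖(h : ℂ) * G x + (m x : ℂ) * U x‖ * ‖U x‖ := by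
      refine (Complex.abs_re_le_norm _).trans ?_
      rw [norm_mul, RCLike.norm_conj]
    have h3 : w x * (((h : ℂ) * G x + (m x : ℂ) * U x) * starRingEnd ℂ (U x)).re ≤
        N * (‖(h : ℂ) * G x + (m x : ℂ) * U x‖ * ‖U x‖) := by
      refine (le_abs_self _).trans ?_
      rw [abs_mul]
      exact mul_le_mul (hN x hx) h2 (abs_nonneg _) ((abs_nonneg _).trans (hN x hx))
    have h4 := mul_le_mul_of_nonneg_right (hκ x hx) (sq_nonneg ‖U x‖)
    rw [h1] at h3
    linarith
  rw [intervalIntegral.integral_const_mul,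
    intervalIntegral.integral_sub (hF.const_mul _) (hE.const_mul _),
    intervalIntegral.integral_const_mul, intervalIntegral.integral_const_mul,
    ← normSq_mul_sub_eq hU hw hw'] at key
  linarith

/-- The constant multiplier is enough where `m` is already at least `κ`; this serves the far ends of
the line. -/
theorem IsPrimitive.estimate_of_le (hU : IsPrimitive U G) (hm : Continuous m)
    {h κ p q : ℝ} (hh : 0 ≤ h) (hpq : p ≤ q) (hκ : ∀ x ∈ Icc p q, κ ≤ m x) :
    κ * ∫ x in p..q, ‖U x‖ ^ 2 ≤
      (∫ x in p..q, ‖(h : ℂ) * G x + (m x : ℂ) * U x‖ * ‖U x‖) + h / 2 * ‖U p‖ ^ 2 := by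
  have := hU.multiplier_estimate hm (h := h) (κ := κ) (N := 1) hpq (w := fun _ => 1)
    (w' := fun _ => 0) (fun x => hasDerivAt_const x 1) continuous_const (fun x _ => by simp)
    (fun x hx => by simpa using hκ x hx)
  have h1 : 0 ≤ h / 2 * ‖U q‖ ^ 2 := by positivity
  linarith

/-- On a short interval, `h U' + m U` controls `U` as soon as `U` vanishes at the left end. -/
theorem IsPrimitive.estimate_short (hU : IsPrimitive U G) (hm : Continuous m)
    {h κ M p q : ℝ} (hpq : p < q) (hM : 0 ≤ M) (hmM : ∀ x ∈ Icc p q, -M ≤ m x)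
    (hlen : (q - p) * (κ + 3 * M) ≤ h) (hh : 0 ≤ h) (hp : U p = 0) :
    κ * ∫ x in p..q, ‖U x‖ ^ 2 ≤
      3 * ∫ x in p..q, ‖(h : ℂ) * G x + (m x : ℂ) * U x‖ * ‖U x‖ := by
  have hqp : 0 < q - p := sub_pos.2 hpq
  have hwb : ∀ x ∈ Icc p q, 0 ≤ (x - p) / (q - p) ∧ (x - p) / (q - p) ≤ 1 := fun x hx =>
    ⟨div_nonneg (sub_nonneg.2 hx.1) hqp.le, (div_le_one hqp).2 (by linarith [hx.2])⟩
  -- The weight falls linearly from `3` to `1`. Its slope contributes `h / (q - p) ≥ κ + 3 M`, which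
  -- absorbs `m w ≥ -3 M`.
  have := hU.multiplier_estimate hm (h := h) (κ := κ) (N := 3) hpq.le
    (w := fun x => 3 - 2 * ((x - p) / (q - p))) (w' := fun _ => -(2 * (1 / (q - p))))
    (fun x => ((((hasDerivAt_id x).sub_const p).div_const (q - p)).const_mul 2).const_sub 3)
    continuous_const
    (fun x hx => by
      have := hwb x hx
      rw [abs_le]; constructor <;> linarith)
    (fun x hx => by
      have h1 := hwb x hx
      have h2 : κ + 3 * M ≤ h / (q - p) := by rw [le_div_iff₀ hqp]; linarith
      have h3 : h / (q - p) = -(h / 2 * -(2 * (1 / (q - p)))) := by ring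
      have h4 := hmM x hx
      have h5 : -(3 * M) ≤ m x * (3 - 2 * ((x - p) / (q - p))) := by
        nlinarith [mul_nonneg hM h1.1]
      linarith)
  have h1 : 0 ≤ h / 2 * ((3 - 2 * ((q - p) / (q - p))) * ‖U q‖ ^ 2) := by
    rw [div_self hqp.ne']; norm_num; positivity
  simp only [hp, norm_zero] at this
  linarith

/-- If `m ≥ 0` grows at least linearly away from the end points of `[p, q]`, then `h U' + m U`
controls `U` with a gain `h ^ (1 / 2)` up to the value of `U` at the left end. -/
theorem IsPrimitive.estimate_of_min_le (hU : IsPrimitive U G) (hm : Continuous m)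
    {h s p q : ℝ} (hh : 0 < h) (hs : 0 < s) (hpq : p ≤ q)
    (hms : ∀ x ∈ Icc p q, s * min (x - p) (q - x) ≤ m x) :
    √(h * s) * ∫ x in p..q, ‖U x‖ ^ 2 ≤
      5 * (∫ x in p..q, ‖(h : ℂ) * G x + (m x : ℂ) * U x‖ * ‖U x‖) +
        h / 2 * (5 * ‖U p‖ ^ 2) := by
  set κ := √(h * s) with hκ
  have hκ0 : 0 < κ := Real.sqrt_pos.2 (by positivity)
  have hκ2 : κ * κ = h * s := Real.mul_self_sqrt (by positivity)
  have hc : h * (s / κ) = κ := by field_simp; linarith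
  have hc' : κ * (s / κ) = s := by field_simp
  set c := s / κ
  have hc0 : 0 < c := by positivity
  have hexp : ∀ x ∈ Icc p q, (Real.exp (-(c * (x - p))) ≤ 1 ∧ 0 < Real.exp (-(c * (x - p)))) ∧
      (Real.exp (-(c * (q - x))) ≤ 1 ∧ 0 < Real.exp (-(c * (q - x)))) := fun x hx =>
    ⟨⟨Real.exp_le_one_iff.2 (neg_nonpos.2 (mul_nonneg hc0.le (sub_nonneg.2 hx.1))),
      Real.exp_pos _⟩,
     ⟨Real.exp_le_one_iff.2 (neg_nonpos.2 (mul_nonneg hc0.le (sub_nonneg.2 hx.2))),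
      Real.exp_pos _⟩⟩
  -- The weight decreases and stays in `[1, 5]`, dropping over a layer of width `1 / c = √(h / s)`
  -- at each end, where `m` may be small. The choice of `c` gives `h c = κ` and `κ c = s`.
  have := hU.multiplier_estimate hm (h := h) (κ := κ) (N := 5) hpq
    (w := fun x => 3 + 2 * Real.exp (-(c * (x - p))) - 2 * Real.exp (-(c * (q - x))))
    (w' := fun x => -(2 * c * (Real.exp (-(c * (x - p))) + Real.exp (-(c * (q - x))))))
    (fun x => by
      have h1 := ((((hasDerivAt_id x).sub_const p).const_mul c).fun_neg.exp).const_mul 2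
      have h2 := ((((hasDerivAt_id x).const_sub q).const_mul c).fun_neg.exp).const_mul 2
      refine ((h1.const_add 3).fun_sub h2).congr_deriv ?_
      simp only [id]
      ring)
    (by fun_prop)
    (fun x hx => by
      obtain ⟨⟨h1, h2⟩, h3, h4⟩ := hexp x hx
      rw [abs_le]; constructor <;> linarith)
    (fun x hx => by
      obtain ⟨⟨h1, h2⟩, h3, h4⟩ := hexp x hx
      have h5 := hms x hx
      have h6 : 0 ≤ s * min (x - p) (q - x) :=
        mul_nonneg hs.le (le_min (sub_nonneg.2 hx.1) (sub_nonneg.2 hx.2))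
      have h7 : m x ≤ m x *
          (3 + 2 * Real.exp (-(c * (x - p))) - 2 * Real.exp (-(c * (q - x)))) :=
        le_mul_of_one_le_right (h6.trans h5) (by linarith)
      have h8 : h / 2 * -(2 * c * (Real.exp (-(c * (x - p))) + Real.exp (-(c * (q - x))))) =
          -(κ * (Real.exp (-(c * (x - p))) + Real.exp (-(c * (q - x))))) := by
        linear_combination (-(Real.exp (-(c * (x - p))) + Real.exp (-(c * (q - x))))) * hc
      rw [h8]
      have h9 := mul_pos hκ0 h2
      have h10 := mul_pos hκ0 h4
      -- At distance `d` from the nearer end, the derivative gives at least `κ exp (-c d) ≥ κ - s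
      -- d`, and `m w ≥ m ≥ s d` restores the missing part.
      rcases min_choice (x - p) (q - x) with h11 | h11 <;> rw [h11] at h5
      · have := mul_le_mul_of_nonneg_left (Real.add_one_le_exp (-(c * (x - p)))) hκ0.le
        linear_combination h7 + h5 + this + h10 + (x - p) * hc'
      · have := mul_le_mul_of_nonneg_left (Real.add_one_le_exp (-(c * (q - x)))) hκ0.le
        linear_combination h7 + h5 + this + h9 + (q - x) * hc')
  obtain ⟨⟨h1, h2⟩, h3, h4⟩ := hexp p ⟨le_rfl, hpq⟩
  obtain ⟨⟨h5, h6⟩, h7, h8⟩ := hexp q ⟨hpq, le_rfl⟩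
  have h9 := mul_le_mul_of_nonneg_right (by linarith :
    3 + 2 * Real.exp (-(c * (p - p))) - 2 * Real.exp (-(c * (q - p))) ≤ 5) (sq_nonneg ‖U p‖)
  have h10 := mul_nonneg (by linarith :
    0 ≤ 3 + 2 * Real.exp (-(c * (q - p))) - 2 * Real.exp (-(c * (q - q)))) (sq_nonneg ‖U q‖)
  refine this.trans ?_
  gcongr
  linarith

theorem IsPrimitive.reflect (hU : IsPrimitive U G) (c : ℝ) :
    IsPrimitive (fun x => U (c - x)) (fun x => -G (c - x)) := by
  refine ⟨fun a b => ?_, fun a b => ?_⟩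
  · have := (hU.1 (c - a) (c - b)).comp_sub_left c
    simp only [sub_sub_cancel] at this
    exact this.neg
  · rw [intervalIntegral.integral_neg, intervalIntegral.integral_comp_sub_left (fun x => G x) c,
      ← hU.2]
    ring

/-- Mirror image of `IsPrimitive.estimate_of_min_le` for `m ≤ 0`. -/
theorem IsPrimitive.estimate_of_le_neg_min (hU : IsPrimitive U G) (hm : Continuous m)
    {h s p q : ℝ} (hh : 0 < h) (hs : 0 < s) (hpq : p ≤ q)
    (hms : ∀ x ∈ Icc p q, m x ≤ -(s * min (x - p) (q - x))) :
    √(h * s) * ∫ x in p..q, ‖U x‖ ^ 2 ≤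
      5 * (∫ x in p..q, ‖(h : ℂ) * G x + (m x : ℂ) * U x‖ * ‖U x‖) +
        h / 2 * (5 * ‖U q‖ ^ 2) := by
  -- Reflecting the interval reverses the derivative, so `h U' + m U` becomes minus the operator
  -- with coefficient `-m ≥ 0`, and the harmful left end becomes the right end.
  have h1 := (hU.reflect (p + q)).estimate_of_min_le (m := fun x => -m (p + q - x)) (by fun_prop)
    hh hs hpq (fun x hx => by
      have := hms (p + q - x) ⟨by linarith [hx.2], by linarith [hx.1]⟩
      rw [min_comm]
      have e1 : p + q - x - p = q - x := by ring
      have e2 : q - (p + q - x) = x - p := by ring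
      rw [e1, e2] at this
      linarith)
  have e1 : ∀ f : ℝ → ℝ, ∫ x in p..q, f (p + q - x) = ∫ x in p..q, f x := fun f => by
    rw [intervalIntegral.integral_comp_sub_left f]
    simp
  rw [e1 (fun x => ‖U x‖ ^ 2)] at h1
  have e2 : ∫ x in p..q, ‖(h : ℂ) * -G (p + q - x) + ((-m (p + q - x) : ℝ) : ℂ) * U (p + q - x)‖ *
      ‖U (p + q - x)‖ = ∫ x in p..q, ‖(h : ℂ) * G x + (m x : ℂ) * U x‖ * ‖U x‖ := by
    rw [← e1 fun x => ‖(h : ℂ) * G x + (m x : ℂ) * U x‖ * ‖U x‖]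
    refine intervalIntegral.integral_congr fun x _ => ?_
    rw [← norm_neg]
    congr 2
    push_cast
    ring
  rw [e2, add_sub_cancel_left] at h1
  exact h1

/-- Vanishing on a sufficiently fine finite set makes `h U' + m U` arbitrarily coercive on a
compact interval. -/
theorem exists_finset_estimate (hm : Continuous m) {h : ℝ} (hh : 0 < h) (κ : ℝ) {p q : ℝ}
    (hpq : p ≤ q) :
    ∃ S : Finset ℝ, ∀ U G : ℝ → ℂ, IsPrimitive U G → (∀ x ∈ S, U x = 0) →
      κ * ∫ x in p..q, ‖U x‖ ^ 2 ≤
        3 * ∫ x in p..q, ‖(h : ℂ) * G x + (m x : ℂ) * U x‖ * ‖U x‖ := by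
  rcases hpq.eq_or_lt with rfl | hpq
  · exact ⟨∅, fun U G _ _ => by simp⟩
  obtain ⟨M, hM⟩ := (isCompact_Icc (a := p) (b := q)).exists_bound_of_continuousOn hm.continuousOn
  have hM0 : 0 ≤ M := (norm_nonneg _).trans (hM p ⟨le_rfl, hpq.le⟩)
  obtain ⟨n, hn⟩ := exists_nat_gt ((q - p) * (|κ| + 3 * M) / h)
  have hn0 : 0 < (n : ℝ) := lt_of_le_of_lt
    (div_nonneg (mul_nonneg (sub_nonneg.2 hpq.le) (by positivity)) hh.le) hn
  have hqp : 0 < q - p := sub_pos.2 hpq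
  let a : ℕ → ℝ := fun i => p + (q - p) / n * i
  have ha : ∀ i, a (i + 1) - a i = (q - p) / n := fun i => by simp only [a]; push_cast; ring
  have ha0 : a 0 = p := by simp [a]
  have han : a n = q := by simp only [a]; field_simp; ring
  have hstep : 0 < (q - p) / n := by positivity
  have hmono : Monotone a := monotone_nat_of_le_succ fun i => by linarith [ha i]
  -- Only left end points of the `n` pieces are needed, since `IsPrimitive.estimate_short` requires
  -- vanishing there alone.
  refine ⟨(Finset.range n).image a, fun U G hU hS => ?_⟩
  have hUc := hU.continuous
  rw [← ha0, ← han, ← intervalIntegral.sum_integral_adjacent_intervals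
      (fun i _ => (by fun_prop : Continuous fun x => ‖U x‖ ^ 2).intervalIntegrable _ _),
    ← intervalIntegral.sum_integral_adjacent_intervals
      (fun i _ => hU.intervalIntegrable_norm_mul hm h _ _), Finset.mul_sum, Finset.mul_sum]
  refine Finset.sum_le_sum fun i hi => ?_
  have hi' := Finset.mem_range.1 hi
  refine hU.estimate_short hm (M := M) (by linarith [ha i]) hM0 (fun x hx => ?_) ?_ hh.le
    (hS _ (Finset.mem_image_of_mem a hi))
  · have h1 : x ∈ Icc p q :=
      ⟨(ha0 ▸ hmono (Nat.zero_le i)).trans hx.1, hx.2.trans (han ▸ hmono hi')⟩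
    exact (abs_le.1 (hM x h1)).1
  · rw [ha]
    have h1 : (q - p) / n * (|κ| + 3 * M) ≤ h := by
      rw [div_lt_iff₀ hh] at hn
      rw [div_mul_eq_mul_div, div_le_iff₀ hn0]
      linarith
    refine le_trans ?_ h1
    gcongr
    exact le_abs_self κ

end Energy

/-! ### Weak derivatives and primitives on the line -/

theorem locallyIntegrable_Lp_two (u : Lp ℂ 2 (volume : Measure ℝ)) :
    LocallyIntegrable u volume :=
  (Lp.memLp u).locallyIntegrable (by norm_num)

theorem exists_support_subset_Ioc {E : Type*} [Zero E] {f : ℝ → E} (hf : HasCompactSupport f) :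
    ∃ R : ℝ, 0 < R ∧ ∀ x, x ∉ Ioo (-R) R → f x = 0 := by
  obtain ⟨R, hR⟩ := hf.isCompact.isBounded.subset_ball 0
  rw [Real.ball_eq_Ioo, zero_sub, zero_add] at hR
  refine ⟨max R 1, by positivity, fun x hx => ?_⟩
  by_contra h0
  have h1 := hR (subset_tsupport f h0)
  exact hx ⟨by linarith [h1.1, le_max_left R 1], h1.2.trans_le (le_max_left _ _)⟩

theorem integral_primitive_mul_deriv {V v φ : ℝ → ℂ} (hV : IsPrimitive V v)
    (hv : LocallyIntegrable v volume) (hφ : ContDiff ℝ ∞ φ) (hc : HasCompactSupport φ) :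
    ∫ x, V x * deriv φ x = -∫ x, v x * φ x := by
  have hφP : IsPrimitive φ (deriv φ) :=
    IsPrimitive.of_hasDerivAt (fun x => ((hφ.differentiable (by simp)) x).hasDerivAt)
      (hφ.continuous_deriv (by simp))
  obtain ⟨R, hR0, hR⟩ := exists_support_subset_Ioc hc
  obtain ⟨R', hR0', hR'⟩ := exists_support_subset_Ioc hc.deriv
  have hP := (hV.mul hφP).2 (-(max R R')) (max R R')
  have e1 : φ (max R R') = 0 := hR _ fun h => absurd h.2 (not_lt.2 (le_max_left _ _))
  have e2 : φ (-(max R R')) = 0 := hR _ fun h =>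
    absurd h.1 (not_lt.2 (neg_le_neg (le_max_left _ _)))
  simp only [e1, e2, mul_zero, sub_zero] at hP
  rw [intervalIntegral.integral_eq_integral_of_support_subset,
    integral_add] at hP
  · linear_combination -hP
  · simpa [mul_comm] using hv.integrable_smul_left_of_hasCompactSupport hφ.continuous hc
  · exact (hV.continuous.mul (hφ.continuous_deriv (by simp))).integrable_of_hasCompactSupport
      (hc.deriv.mul_left)
  · intro x hx
    by_contra hx'
    apply hx
    have h1 : φ x = 0 := hR _ fun h => hx' ⟨by linarith [h.1, neg_le_neg (le_max_left R R')],
      (h.2.trans_le (le_max_left _ _)).le⟩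
    have h2 : deriv φ x = 0 := hR' _ fun h => hx'
      ⟨by linarith [h.1, neg_le_neg (le_max_right R R')], (h.2.trans_le (le_max_right _ _)).le⟩
    simp [h1, h2]

/-- A smooth compactly supported function with integral zero is the derivative of such a
function. -/
theorem exists_deriv_eq_of_integral_eq_zero {ψ : ℝ → ℝ} (hψ : ContDiff ℝ ∞ ψ)
    (hc : HasCompactSupport ψ) (h0 : ∫ x, ψ x = 0) :
    ∃ φ : ℝ → ℝ, ContDiff ℝ ∞ φ ∧ HasCompactSupport φ ∧ deriv φ = ψ := by
  obtain ⟨R, hR0, hR⟩ := exists_support_subset_Ioc hc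
  let φ : ℝ → ℝ := fun y => ∫ x in (-R)..y, ψ x
  have hd : ∀ y, HasDerivAt φ (ψ y) y := fun y =>
    (hψ.continuous.integral_hasStrictDerivAt (-R) y).hasDerivAt
  have hderiv : deriv φ = ψ := funext fun y => (hd y).deriv
  refine ⟨φ, ?_, ?_, hderiv⟩
  · rw [contDiff_infty_iff_deriv, hderiv]
    exact ⟨fun y => (hd y).differentiableAt, hψ⟩
  · refine HasCompactSupport.intro (isCompact_Icc (a := -R) (b := R)) fun y hy => ?_
    rcases lt_or_ge y (-R) with h1 | h1
    · change ∫ x in (-R)..y, ψ x = 0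
      refine intervalIntegral.integral_zero_ae (ae_of_all _ fun x hx => hR x fun hx' => ?_)
      rw [uIoc_of_ge h1.le] at hx
      linarith [hx.2, hx'.1]
    · have h2 : R < y := by
        by_contra h2
        exact hy ⟨h1, not_lt.1 h2⟩
      change ∫ x in (-R)..y, ψ x = 0
      rw [intervalIntegral.integral_eq_integral_of_support_subset, h0]
      intro x hx
      by_contra hx'
      exact hx (hR x fun h => hx' ⟨h.1, (h.2.trans h2).le⟩)

/-- Du Bois-Reymond: a locally integrable function with vanishing weak derivative is constant. -/
theorem ae_eq_const_of_integral_deriv_eq_zero {f : ℝ → ℂ} (hf : LocallyIntegrable f volume)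
    (h : ∀ φ : ℝ → ℝ, ContDiff ℝ ∞ φ → HasCompactSupport φ →
      ∫ x, ((deriv φ x : ℝ) : ℂ) * f x = 0) :
    ∃ c : ℂ, ∀ᵐ x, f x = c := by
  let b : ContDiffBump (0 : ℝ) := ⟨1, 2, one_pos, one_lt_two⟩
  let η : ℝ → ℝ := b.normed volume
  have hη : ContDiff ℝ ∞ η := b.contDiff_normed
  have hηc : HasCompactSupport η := b.hasCompactSupport_normed
  have hη1 : ∫ x, η x = 1 := b.integral_normed
  have hintg : ∀ g : ℝ → ℝ, ContDiff ℝ ∞ g → HasCompactSupport g →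
      Integrable fun x => (g x : ℂ) * f x := fun g hg hgc => by
    simpa using hf.integrable_smul_left_of_hasCompactSupport hg.continuous hgc
  let c : ℂ := ∫ x, (η x : ℂ) * f x
  refine ⟨c, ?_⟩
  have key : ∀ᵐ x, f x - c = 0 := by
    refine ae_eq_zero_of_integral_contDiff_smul_eq_zero
      (hf.sub (locallyIntegrable_const c)) fun g hg hgc => ?_
    set I := ∫ x, g x with hI
    have hgi : Integrable g := hg.continuous.integrable_of_hasCompactSupport hgc
    have hηi : Integrable η := hη.continuous.integrable_of_hasCompactSupport hηc
    have hψc : HasCompactSupport fun x => g x - I * η x := hgc.sub hηc.mul_left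
    -- Subtracting `I * η` makes the integral zero, so the difference is an admissible derivative
    -- and testing against `g` reduces to testing against `η`.
    obtain ⟨φ, hφ, hφc, hφd⟩ := exists_deriv_eq_of_integral_eq_zero
      (ψ := fun x => g x - I * η x) (hg.sub (contDiff_const.mul hη)) hψc (by
        rw [integral_sub hgi (hηi.const_mul I), integral_const_mul, hη1, ← hI]; ring)
    have h1 := h φ hφ hφc
    rw [hφd] at h1
    have h2 : ∫ x, ((g x - I * η x : ℝ) : ℂ) * f x = (∫ x, (g x : ℂ) * f x) - I * c := by
      rw [← integral_const_mul, ← integral_sub (hintg g hg hgc) ((hintg η hη hηc).const_mul _)]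
      refine integral_congr_ae (ae_of_all _ fun x => ?_)
      push_cast; ring
    rw [h2] at h1
    have hgc' : Integrable fun x => (g x : ℂ) * c := hgi.ofReal.mul_const c
    have h3 : ∫ x, g x • (f x - c) = (∫ x, (g x : ℂ) * f x) - (∫ x, (g x : ℂ)) * c := by
      rw [← integral_mul_const, ← integral_sub (hintg g hg hgc) (hgc' : Integrable fun x => (g x : ℂ) * c)]
      refine integral_congr_ae (ae_of_all _ fun x => ?_)
      simp only [Complex.real_smul]; ring
    change ∫ x, g x • (f x - c) = 0
    rw [h3, integral_complex_ofReal, ← hI, h1]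
  filter_upwards [key] with x hx
  exact sub_eq_zero.1 hx

theorem IsWeakDeriv.exists_isPrimitive_line {u v : Lp ℂ 2 (volume : Measure ℝ)}
    (h : IsWeakDeriv lineTests u v) : ∃ U : ℝ → ℂ, IsPrimitive U v ∧ ∀ᵐ x, u x = U x := by
  have hv := locallyIntegrable_Lp_two v
  have hu := locallyIntegrable_Lp_two u
  have hV := IsPrimitive.integral (G := v) fun a b =>
    (hv.integrableOn_isCompact isCompact_uIcc).intervalIntegrable
  set V : ℝ → ℂ := fun x => ∫ y in (0 : ℝ)..x, v y with hVdef
  obtain ⟨c, hc⟩ := ae_eq_const_of_integral_deriv_eq_zero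
    (f := fun x => u x - V x) (hu.sub hV.continuous.locallyIntegrable) (fun φ hφ hφc => by
      have hφ' : ContDiff ℝ ∞ fun x => (φ x : ℂ) := Complex.ofRealCLM.contDiff.comp hφ
      have hφc' : HasCompactSupport fun x => (φ x : ℂ) := hφc.comp_left Complex.ofReal_zero
      have hd : deriv (fun x => (φ x : ℂ)) = fun x => ((deriv φ x : ℝ) : ℂ) := funext fun x =>
        (((hφ.differentiable (by simp)) x).hasDerivAt.ofReal_comp).deriv
      have h1 := h (fun x => (φ x : ℂ), deriv fun x => (φ x : ℂ)) ⟨hφ', hφc', rfl⟩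
      have h2 := integral_primitive_mul_deriv hV hv hφ' hφc'
      have h3 : ∫ x, u x * deriv (fun x => (φ x : ℂ)) x =
          ∫ x, V x * deriv (fun x => (φ x : ℂ)) x := h1.trans h2.symm
      have hm := lineTests.memLp (fun x => (φ x : ℂ), deriv fun x => (φ x : ℂ)) ⟨hφ', hφc', rfl⟩
      have hi1 := integrable_mul_test u hm.2
      have hi2 : Integrable fun x => V x * deriv (fun x => (φ x : ℂ)) x :=
        (hV.continuous.mul (hφ'.continuous_deriv (by simp))).integrable_of_hasCompactSupport
          (hφc'.deriv.mul_left)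
      rw [← sub_eq_zero, ← integral_sub hi1 hi2, hd] at h3
      rw [← h3]
      refine integral_congr_ae (ae_of_all _ fun x => ?_)
      ring)
  refine ⟨fun x => V x + c, ⟨hV.1, fun a b => ?_⟩, ?_⟩
  · rw [← hV.2]; ring
  · filter_upwards [hc] with x hx
    rw [← hx]; ring

/-! ### Weak derivatives and primitives on the circle -/

/-- The preimage of a null set is periodic and meets each of countably many periods in a null set.
Almost-everywhere identities therefore lift from the circle to the line. -/
theorem quasiMeasurePreserving_circ :
    Measure.QuasiMeasurePreserving (fun x : ℝ => (x : Circ)) volume volume := by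
  refine ⟨AddCircle.measurable_mk', ?_⟩
  refine Measure.AbsolutelyContinuous.mk fun s hs h0 => ?_
  rw [Measure.map_apply AddCircle.measurable_mk' hs]
  have hcov : ((fun x : ℝ => (x : Circ)) ⁻¹' s) =
      ⋃ n : ℤ, ((fun x : ℝ => (x : Circ)) ⁻¹' s) ∩
        Ioc (n • (2 * Real.pi)) (n • (2 * Real.pi) + 2 * Real.pi) := by
    rw [← inter_iUnion]
    have : ⋃ n : ℤ, Ioc (n • (2 * Real.pi)) (n • (2 * Real.pi) + 2 * Real.pi) = univ := by
      simpa [add_smul, one_smul] using iUnion_Ioc_zsmul Real.two_pi_pos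
    rw [this, inter_univ]
  rw [hcov, measure_iUnion_null_iff]
  intro n
  have h1 := AddCircle.add_projection_respects_measure (T := 2 * Real.pi) (n • (2 * Real.pi)) hs
  rw [h0] at h1
  exact h1.symm

theorem continuous_lift_circ {f : ℝ → ℂ} (hf : Function.Periodic f (2 * Real.pi))
    (hc : Continuous f) : Continuous (hf.lift : Circ → ℂ) :=
  isQuotientMap_quotient_mk'.continuous_iff.2 hc

theorem intervalIntegrable_Lp_circ (v : Lp ℂ 2 (volume : Measure Circ)) (a b : ℝ) :
    IntervalIntegrable (fun x : ℝ => v (x : Circ)) volume a b := by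
  have hper : Function.Periodic (fun x : ℝ => v (x : Circ)) (2 * Real.pi) := fun x => by
    simp only [AddCircle.coe_add_period]
  refine hper.intervalIntegrable₀ Real.two_pi_pos.ne' ?_ a b
  rw [intervalIntegrable_iff_integrableOn_Ioc_of_le Real.two_pi_pos.le]
  have hi : Integrable v volume := (Lp.memLp v).integrable (by norm_num)
  have := (AddCircle.measurePreserving_mk (2 * Real.pi) 0).integrable_comp_of_integrable hi
  rw [zero_add] at this
  exact this

theorem intervalIntegral_circ {E : Type*} [NormedAddCommGroup E] [NormedSpace ℝ E] (a : ℝ)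
    (f : Circ → E) : ∫ x in a..a + 2 * Real.pi, f (x : Circ) = ∫ y : Circ, f y :=
  AddCircle.intervalIntegral_preimage (2 * Real.pi) a f

theorem IsWeakDeriv.exists_isPrimitive_circ {u v : Lp ℂ 2 (volume : Measure Circ)}
    (h : IsWeakDeriv circTests u v) :
    ∃ U : ℝ → ℂ, IsPrimitive U (fun x => v (x : Circ)) ∧ ∀ᵐ x : ℝ, u (x : Circ) = U x := by
  have hV := IsPrimitive.integral (intervalIntegrable_Lp_circ v)
  set V : ℝ → ℂ := fun x => ∫ y in (0 : ℝ)..x, v (y : Circ) with hVdef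
  have hcont : ∀ f : Circ → ℂ, Continuous f → MemLp f 2 (volume : Measure Circ) := fun f hf =>
    hf.memLp_of_hasCompactSupport (HasCompactSupport.of_compactSpace f)
  -- Testing against the constant `1` gives mean zero, exactly the condition for the primitive `V`
  -- to be periodic.
  have hv0 : ∫ y, v y = 0 := by
    have := h (fun _ => 1, fun _ => 0) ⟨contDiff_const, fun y => by simp⟩
    simpa using this
  have hper : Function.Periodic V (2 * Real.pi) := fun x => by
    have := hV.2 x (x + 2 * Real.pi)
    rw [intervalIntegral_circ x v, hv0] at this
    exact sub_eq_zero.1 this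
  let W : Circ → ℂ := hper.lift
  have hWV : ∀ x : ℝ, W (x : Circ) = V x := fun x => hper.lift_coe x
  have hWc : Continuous W := continuous_lift_circ hper hV.continuous
  have hfm : MemLp (fun y => u y - W y) 2 (volume : Measure Circ) :=
    (Lp.memLp u).sub (hcont W hWc)
  have hfi : Integrable (fun y => u y - W y) (volume : Measure Circ) :=
    hfm.integrable (by norm_num)
  -- the difference of `u` and the primitive has vanishing weak derivative
  have hf : ∀ p ∈ circTests.pairs, ∫ y, (u y - W y) * p.2 y = 0 := by
    intro p hp
    have hφ : ContDiff ℝ ∞ fun x : ℝ => p.1 (x : Circ) := hp.1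
    have hφP : IsPrimitive (fun x : ℝ => p.1 (x : Circ)) (fun x : ℝ => p.2 (x : Circ)) := by
      refine IsPrimitive.of_hasDerivAt (fun x => ?_) ?_
      · rw [hp.2]
        exact ((hφ.differentiable (by simp)) x).hasDerivAt
      · simp only [hp.2]
        exact hφ.continuous_deriv (by simp)
    have h1 := (hV.mul hφP).2 0 (0 + 2 * Real.pi)
    have e1 : ((0 + 2 * Real.pi : ℝ) : Circ) = ((0 : ℝ) : Circ) := AddCircle.coe_add_period _ _
    have e2 : V (0 + 2 * Real.pi) = V 0 := hper 0
    simp only [e2] at h1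
    rw [e1, sub_self] at h1
    simp only [← hWV] at h1
    rw [intervalIntegral_circ 0 (fun y => v y * p.1 y + W y * p.2 y)] at h1
    have hpm := circTests.memLp p hp
    have hi1 := integrable_mul_test v hpm.1
    have hi2 : Integrable (fun y => W y * p.2 y) volume := (hcont W hWc).integrable_mul hpm.2
    rw [integral_add hi1 hi2] at h1
    have h2 := h p hp
    have hi3 := integrable_mul_test u hpm.2
    have h3 : ∫ y, (u y - W y) * p.2 y = (∫ y, u y * p.2 y) - ∫ y, W y * p.2 y := by
      rw [← integral_sub hi3 hi2]
      refine integral_congr_ae (ae_of_all _ fun y => ?_)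
      ring
    rw [h3, h2]
    linear_combination h1
  have hpi : ((2 * Real.pi : ℝ) : ℂ) ≠ 0 := by exact_mod_cast Real.two_pi_pos.ne'
  let c : ℂ := (∫ y, (u y - W y)) / (2 * Real.pi : ℝ)
  have hgm : MemLp (fun y => (u y - W y) - c) 2 (volume : Measure Circ) :=
    hfm.sub (memLp_const c)
  have hz : hgm.toLp = 0 := by
    refine circTests.separating _ fun p hp => ?_
    have hg : ContDiff ℝ ∞ fun x : ℝ => p.1 (x : Circ) := hp.1
    have hpm := (circTests.memLp p hp).1
    have hpi1 : Integrable p.1 (volume : Measure Circ) := hpm.integrable (by norm_num)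
    -- The circle version of du Bois-Reymond: once its mean `d` is removed, a test function is the
    -- derivative of a periodic smooth function.
    let d : ℂ := (∫ y, p.1 y) / (2 * Real.pi : ℝ)
    have hψ : ContDiff ℝ ∞ fun x : ℝ => p.1 (x : Circ) - d := hg.sub contDiff_const
    let φ : ℝ → ℂ := fun x => ∫ y in (0 : ℝ)..x, (p.1 (y : Circ) - d)
    have hd : ∀ x : ℝ, HasDerivAt φ (p.1 (x : Circ) - d) x := fun x =>
      (hψ.continuous.integral_hasStrictDerivAt 0 x).hasDerivAt
    have hderiv : deriv φ = fun x : ℝ => p.1 (x : Circ) - d := funext fun x => (hd x).deriv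
    have hφ : ContDiff ℝ ∞ φ := by
      rw [contDiff_infty_iff_deriv, hderiv]
      exact ⟨fun x => (hd x).differentiableAt, hψ⟩
    have hφper : Function.Periodic φ (2 * Real.pi) := fun x => by
      have h1 := (IsPrimitive.of_hasDerivAt hd hψ.continuous).2 x (x + 2 * Real.pi)
      rw [intervalIntegral_circ x (fun y => p.1 y - d), integral_sub hpi1 (integrable_const d)]
        at h1
      have h2 : ∫ _ : Circ, d = ∫ y, p.1 y := by
        rw [integral_const, Measure.real, AddCircle.measure_univ,
          ENNReal.toReal_ofReal Real.two_pi_pos.le, Complex.real_smul]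
        exact mul_div_cancel₀ _ hpi
      rw [h2, sub_self] at h1
      exact sub_eq_zero.1 h1
    have h1 := hf (hφper.lift, fun y => p.1 y - d) ⟨by
      simpa only [Function.Periodic.lift_coe] using hφ, fun y => by
      simp only [Function.Periodic.lift_coe]
      rw [show (fun s => φ s) = φ from rfl, hderiv]⟩
    have hi : Integrable (fun y => (u y - W y) * p.1 y) volume := hfm.integrable_mul hpm
    have h2 : ∫ y, (u y - W y) * (p.1 y - d) =
        (∫ y, (u y - W y) * p.1 y) - (∫ y, (u y - W y)) * d := by
      rw [← integral_mul_const, ← integral_sub hi (hfi.mul_const d)]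
      refine integral_congr_ae (ae_of_all _ fun y => ?_)
      ring
    have h3 : ∫ y, (hgm.toLp : Lp ℂ 2 (volume : Measure Circ)) y * p.1 y = (∫ y, (u y - W y) * p.1 y) - c * ∫ y, p.1 y := by
      rw [← integral_const_mul, ← integral_sub hi (hpi1.const_mul c)]
      refine integral_congr_ae ?_
      filter_upwards [hgm.coeFn_toLp] with y hy
      rw [hy]
      ring
    rw [h3]
    rw [h2] at h1
    have h4 : (∫ y, (u y - W y)) * d = c * ∫ y, p.1 y := by
      simp only [c, d]; ring
    rw [← h4]
    exact h1
  have hae : ∀ᵐ y : Circ, u y - W y - c = 0 := by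
    filter_upwards [hgm.coeFn_toLp, Lp.eq_zero_iff_ae_eq_zero.1 hz] with y h1 h2
    rw [← h1, h2]; rfl
  refine ⟨fun x => V x + c, ⟨hV.1, fun a b => ?_⟩, ?_⟩
  · rw [← hV.2]; ring
  · filter_upwards [quasiMeasurePreserving_circ.ae hae] with x hx
    rw [hWV] at hx
    linear_combination hx

section GenericOp

variable {Y : Type*} [MeasurableSpace Y] {μ : Measure Y}

/-! ### The Hilbert space `L²` -/

theorem norm_sq_eq_integral (f : Lp ℂ 2 μ) : ‖f‖ ^ 2 = ∫ y, ‖f y‖ ^ 2 ∂μ := by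
  have h1 : inner ℂ f f = ((∫ y, ‖f y‖ ^ 2 ∂μ : ℝ) : ℂ) := by
    rw [L2.inner_def, ← integral_complex_ofReal]
    refine integral_congr_ae (ae_of_all _ fun y => ?_)
    simp only [inner_self_eq_norm_sq_to_K]
    norm_cast
  rw [← inner_self_eq_norm_sq (𝕜 := ℂ), h1]
  exact Complex.ofReal_re _

theorem integrable_norm_sq (f : Lp ℂ 2 μ) : Integrable (fun y => ‖f y‖ ^ 2) μ :=
  (memLp_two_iff_integrable_sq_norm (Lp.memLp f).1).1 (Lp.memLp f)

theorem integrable_norm_mul_norm (f g : Lp ℂ 2 μ) : Integrable (fun y => ‖f y‖ * ‖g y‖) μ :=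
  MemLp.integrable_mul (Lp.memLp f).norm (Lp.memLp g).norm

theorem integral_norm_mul_norm_le (f g : Lp ℂ 2 μ) : ∫ y, ‖f y‖ * ‖g y‖ ∂μ ≤ ‖f‖ * ‖g‖ := by
  have hn : ∀ f : Lp ℂ 2 μ, ‖(Lp.memLp f).norm.toLp‖ = ‖f‖ := fun f => by
    rw [Lp.norm_toLp, eLpNorm_norm, Lp.norm_def]
  have h1 := real_inner_le_norm (Lp.memLp g).norm.toLp (Lp.memLp f).norm.toLp
  rw [hn, hn, L2.inner_def, mul_comm] at h1
  refine le_trans (le_of_eq ?_) h1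
  refine integral_congr_ae ?_
  filter_upwards [(Lp.memLp f).norm.coeFn_toLp, (Lp.memLp g).norm.coeFn_toLp] with y h2 h3
  rw [h2, h3]
  simp

/-- Cauchy-Schwarz on the right-hand side, then division by `‖u‖`. This turns the quadratic energy
estimates into coercivity. -/
theorem mul_norm_le_of_integral_le {u f : Lp ℂ 2 μ} {κ N : ℝ} (hN : 0 ≤ N)
    (h : κ * ∫ y, ‖u y‖ ^ 2 ∂μ ≤ N * ∫ y, ‖f y‖ * ‖u y‖ ∂μ) : κ * ‖u‖ ≤ N * ‖f‖ := by
  rcases (norm_nonneg u).eq_or_lt with h0 | h0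
  · rw [← h0, mul_zero]; positivity
  · rw [← norm_sq_eq_integral] at h
    have h1 := h.trans (mul_le_mul_of_nonneg_left (integral_norm_mul_norm_le f u) hN)
    refine le_of_mul_le_mul_right ?_ h0
    linarith

theorem integral_toLp_mul {f : Y → ℂ} (hf : MemLp f 2 μ) (φ : Y → ℂ) :
    ∫ y, (hf.toLp : Lp ℂ 2 μ) y * φ y ∂μ = ∫ y, f y * φ y ∂μ := by
  refine integral_congr_ae ?_
  filter_upwards [hf.coeFn_toLp] with y hy
  rw [hy]

theorem continuous_integral_mul {φ : Y → ℂ} (hφ : MemLp φ 2 μ) :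
    Continuous fun u : Lp ℂ 2 μ => ∫ y, u y * φ y ∂μ := by
  have h1 : (fun u : Lp ℂ 2 μ => ∫ y, u y * φ y ∂μ) =
      fun u => inner ℂ hφ.star.toLp u := by
    funext u
    rw [L2.inner_def]
    refine integral_congr_ae ?_
    filter_upwards [hφ.star.coeFn_toLp] with y hy
    rw [hy]
    simp
  rw [h1]
  fun_prop

/-! ### Evaluation of elements of the domain -/

/-- Along `π : ℝ → Y`, functions with a weak derivative are primitives of that derivative. -/
structure HasPrimitives (T : TestClass μ) (π : ℝ → Y) : Prop where
  quasi : Measure.QuasiMeasurePreserving π volume μ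
  exists_isPrimitive : ∀ u v : Lp ℂ 2 μ, IsWeakDeriv T u v →
    ∃ U : ℝ → ℂ, IsPrimitive U (fun x => v (π x)) ∧ ∀ᵐ x, u (π x) = U x

variable {T : TestClass μ} {π : ℝ → Y} {w : Y → ℝ}

/-- The continuous representative of an element of `weightedH1`. -/
def evalMap (hT : HasPrimitives T π) (w : Y → ℝ) : weightedH1 T w →ₗ[ℂ] (ℝ → ℂ) where
  toFun u := (hT.exists_isPrimitive _ _ (weakDeriv_spec u)).choose
  map_add' u v := by
    have hu := (hT.exists_isPrimitive _ _ (weakDeriv_spec u)).choose_spec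
    have hv := (hT.exists_isPrimitive _ _ (weakDeriv_spec v)).choose_spec
    have huv := (hT.exists_isPrimitive _ _ (weakDeriv_spec (u + v))).choose_spec
    -- Continuous representatives are unique, so the arbitrary choice of primitive is automatically
    -- linear.
    refine (Continuous.ae_eq_iff_eq volume huv.1.continuous
      (hu.1.continuous.add hv.1.continuous)).1 ?_
    filter_upwards [hu.2, hv.2, huv.2,
      hT.quasi.ae (Lp.coeFn_add (u : Lp ℂ 2 μ) v)] with x h1 h2 h3 h4
    rw [← h3, Submodule.coe_add, h4, Pi.add_apply, Pi.add_apply, h1, h2]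
  map_smul' c u := by
    have hu := (hT.exists_isPrimitive _ _ (weakDeriv_spec u)).choose_spec
    have hcu := (hT.exists_isPrimitive _ _ (weakDeriv_spec (c • u))).choose_spec
    refine (Continuous.ae_eq_iff_eq volume hcu.1.continuous
      (hu.1.continuous.const_smul c)).1 ?_
    filter_upwards [hu.2, hcu.2, hT.quasi.ae (Lp.coeFn_smul c (u : Lp ℂ 2 μ))] with x h1 h2 h3
    rw [← h2, Submodule.coe_smul, h3, Pi.smul_apply, Pi.smul_apply, h1]

theorem evalMap_isPrimitive (hT : HasPrimitives T π) (u : weightedH1 T w) :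
    IsPrimitive (evalMap hT w u) fun x => weakDeriv u (π x) :=
  (hT.exists_isPrimitive _ _ (weakDeriv_spec u)).choose_spec.1

theorem evalMap_ae_eq (hT : HasPrimitives T π) (u : weightedH1 T w) :
    ∀ᵐ x, (u : Lp ℂ 2 μ) (π x) = evalMap hT w u x :=
  (hT.exists_isPrimitive _ _ (weakDeriv_spec u)).choose_spec.2

variable {m : Y → ℝ} {hm : AEStronglyMeasurable m μ} {hmw : ∃ c : ℝ, ∀ y, |m y| ≤ c * w y} {h : ℝ}

theorem firstOrderOp_ae_eq (hT : HasPrimitives T π) (u : weightedH1 T w) :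
    ∀ᵐ x, (firstOrderOp T w m hm hmw h u : Lp ℂ 2 μ) (π x) =
      (h : ℂ) * weakDeriv u (π x) + (m (π x) : ℂ) * evalMap hT w u x := by
  have h1 : firstOrderOp T w m hm hmw h u =
      (h : ℂ) • weakDeriv u + (memLp_mul hm hmw u).toLp := rfl
  rw [h1]
  filter_upwards [evalMap_ae_eq hT u, hT.quasi.ae (Lp.coeFn_smul (h : ℂ) (weakDeriv u)),
    hT.quasi.ae (Lp.coeFn_add ((h : ℂ) • weakDeriv u) (memLp_mul hm hmw u).toLp),
    hT.quasi.ae (memLp_mul hm hmw u).coeFn_toLp] with x h1 h2 h3 h4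
  rw [h3, Pi.add_apply, h2, h4, Pi.smul_apply, smul_eq_mul, h1]

/-- Evaluation at the points of a finite set. -/
def evalAt (hT : HasPrimitives T π) (w : Y → ℝ) (S : Finset ℝ) :
    weightedH1 T w →ₗ[ℂ] (S → ℂ) :=
  LinearMap.funLeft ℂ ℂ (fun x : S => (x : ℝ)) ∘ₗ evalMap hT w

/-! ### Density and closedness -/

theorem dense_weightedH1 (htest : ∀ p ∈ T.pairs, MemLp (fun y => (w y : ℂ) * p.1 y) 2 μ ∧
    ∀ q ∈ T.pairs, ∫ y, p.1 y * q.2 y ∂μ = -∫ y, p.2 y * q.1 y ∂μ) :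
    Dense (weightedH1 T w : Set (Lp ℂ 2 μ)) := by
  rw [Submodule.dense_iff_topologicalClosure_eq_top, Submodule.topologicalClosure_eq_top_iff,
    Submodule.eq_bot_iff]
  intro u hu
  -- `separating` uses the bilinear pairing and orthogonality the sesquilinear one; conjugation
  -- passes between them.
  have hstar : star u = 0 := by
    refine T.separating _ fun p hp => ?_
    have hpm := T.memLp p hp
    have hmem : hpm.1.toLp ∈ weightedH1 T w := by
      refine ⟨(memLp_congr_ae ?_).2 (htest p hp).1, hpm.2.toLp, fun q hq => ?_⟩
      · filter_upwards [hpm.1.coeFn_toLp] with y hy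
        rw [hy]
      · rw [integral_toLp_mul, integral_toLp_mul]
        exact (htest p hp).2 q hq
    have h1 := (Submodule.mem_orthogonal' _ _).1 hu _ hmem
    rw [L2.inner_def] at h1
    rw [← h1]
    refine integral_congr_ae ?_
    filter_upwards [hpm.1.coeFn_toLp, Lp.coeFn_star u] with y h2 h3
    rw [h2, h3]
    simp [mul_comm]
  refine Lp.eq_zero_iff_ae_eq_zero.2 ?_
  filter_upwards [Lp.coeFn_star u, Lp.eq_zero_iff_ae_eq_zero.1 hstar] with y h1 h2
  rw [h1, Pi.star_apply, Pi.zero_apply] at h2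
  exact star_eq_zero.1 h2

/-- `h ∂ + m` is closed if its graph norm controls the weighted norm of the domain. -/
theorem isClosed_firstOrderOp (hw : AEStronglyMeasurable w μ) (hh : h ≠ 0)
    (hmtest : ∀ p ∈ T.pairs, MemLp (fun y => (m y : ℂ) * p.1 y) 2 μ) {C : ℝ} (hC : 0 ≤ C)
    (hest : ∀ u : weightedH1 T w,
      ‖u.2.1.toLp‖ ≤ C * (‖(u : Lp ℂ 2 μ)‖ + ‖firstOrderOp T w m hm hmw h u‖)) :
    (firstOrderOp T w m hm hmw h).IsClosed := by
  refine IsSeqClosed.isClosed ?_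
  rintro x ⟨u, f⟩ hx hlim
  have hu : Tendsto (fun n => (x n).1) atTop (nhds u) := (continuous_fst.tendsto _).comp hlim
  have hf : Tendsto (fun n => (x n).2) atTop (nhds f) := (continuous_snd.tendsto _).comp hlim
  choose z hz1 hz2 using fun n => (LinearPMap.mem_graph_iff _).1 (hx n)
  -- Fatou along an almost everywhere convergent subsequence: `hest` bounds the weighted norms
  -- uniformly.
  have hwu : MemLp (fun y => (w y : ℂ) * u y) 2 μ := by
    obtain ⟨ns, -, hns⟩ := (tendstoInMeasure_of_tendsto_Lp hu).exists_seq_tendsto_ae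
    obtain ⟨B1, hB1⟩ := hu.norm.bddAbove_range
    obtain ⟨B2, hB2⟩ := hf.norm.bddAbove_range
    have hzm : ∀ n, MemLp (fun y => (w y : ℂ) * (z n : Lp ℂ 2 μ) y) 2 μ := fun n => (z n).2.1
    have hb : ∀ n, eLpNorm (fun y => (w y : ℂ) * (z n : Lp ℂ 2 μ) y) 2 μ ≤
        ENNReal.ofReal (C * (B1 + B2)) := by
      intro n
      rw [← ENNReal.ofReal_toReal (hzm n).2.ne, ← Lp.norm_toLp _ (hzm n)]
      refine ENNReal.ofReal_le_ofReal ((hest (z n)).trans ?_)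
      gcongr
      · rw [hz1]; exact hB1 ⟨n, rfl⟩
      · refine le_trans (le_of_eq ?_) (hB2 ⟨n, rfl⟩)
        exact congrArg norm (hz2 n)
    refine ⟨(Complex.continuous_ofReal.comp_aestronglyMeasurable hw).mul (Lp.memLp u).1, ?_⟩
    refine lt_of_le_of_lt (Lp.eLpNorm_le_of_ae_tendsto (u := atTop)
      (Eventually.of_forall fun k => hb (ns k)) (fun k => (hzm (ns k)).1) ?_)
      ENNReal.ofReal_lt_top
    filter_upwards [hns] with y hy
    refine Tendsto.const_mul _ ?_
    simpa only [hz1] using hy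
  have hmu : MemLp (fun y => (m y : ℂ) * u y) 2 μ := by
    obtain ⟨c, hc⟩ := hmw
    refine MemLp.of_le_mul (c := |c|) hwu
      ((Complex.continuous_ofReal.comp_aestronglyMeasurable hm).mul (Lp.memLp u).1)
      (ae_of_all _ fun y => ?_)
    rw [norm_mul, norm_mul, ← mul_assoc, Complex.norm_real, Complex.norm_real,
      Real.norm_eq_abs, Real.norm_eq_abs, ← abs_mul]
    exact mul_le_mul_of_nonneg_right ((hc y).trans (le_abs_self _)) (norm_nonneg _)
  have hhC : (h : ℂ) ≠ 0 := by exact_mod_cast hh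
  -- The equation `f = h v + m u` forces this candidate; the weak-derivative identity passes to the
  -- limit against each fixed test function.
  let v : Lp ℂ 2 μ := (h : ℂ)⁻¹ • (f + (-1 : ℂ) • hmu.toLp)
  have hv : IsWeakDeriv T u v := by
    intro p hp
    have hpm := T.memLp p hp
    have hmp := hmtest p hp
    have hn : ∀ n, (h : ℂ) * ∫ y, (x n).1 y * p.2 y ∂μ =
        -((∫ y, (x n).2 y * p.1 y ∂μ) - ∫ y, (x n).1 y * ((m y : ℂ) * p.1 y) ∂μ) := by
      intro n
      have h1 : (x n).2 = (h : ℂ) • weakDeriv (z n) + (memLp_mul hm hmw (z n)).toLp :=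
        (hz2 n).symm
      have h2 : ∫ y, (m y : ℂ) * (z n : Lp ℂ 2 μ) y * p.1 y ∂μ =
          ∫ y, (z n : Lp ℂ 2 μ) y * ((m y : ℂ) * p.1 y) ∂μ :=
        integral_congr_ae (ae_of_all _ fun y => by ring)
      rw [h1, integral_add_mul _ _ hpm.1, integral_smul_mul, integral_toLp_mul, h2, ← hz1,
        weakDeriv_spec (z n) p hp]
      ring
    have hL : Tendsto (fun n => (h : ℂ) * ∫ y, (x n).1 y * p.2 y ∂μ) atTop
        (nhds ((h : ℂ) * ∫ y, u y * p.2 y ∂μ)) :=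
      (((continuous_integral_mul hpm.2).tendsto u).comp hu).const_mul _
    have hR : Tendsto (fun n => -((∫ y, (x n).2 y * p.1 y ∂μ) -
        ∫ y, (x n).1 y * ((m y : ℂ) * p.1 y) ∂μ)) atTop
        (nhds (-((∫ y, f y * p.1 y ∂μ) - ∫ y, u y * ((m y : ℂ) * p.1 y) ∂μ))) :=
      ((((continuous_integral_mul hpm.1).tendsto f).comp hf).sub
        (((continuous_integral_mul hmp).tendsto u).comp hu)).neg
    have hlimeq := tendsto_nhds_unique (hL.congr hn) hR
    have h2 : ∫ y, (m y : ℂ) * u y * p.1 y ∂μ = ∫ y, u y * ((m y : ℂ) * p.1 y) ∂μ :=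
      integral_congr_ae (ae_of_all _ fun y => by ring)
    rw [integral_smul_mul, integral_add_mul _ _ hpm.1, integral_smul_mul, integral_toLp_mul,
      h2]
    apply mul_left_cancel₀ hhC
    rw [hlimeq, mul_neg, mul_inv_cancel_left₀ hhC]
    ring
  let U : weightedH1 T w := ⟨u, hwu, v, hv⟩
  refine (LinearPMap.mem_graph_iff _).2 ⟨U, rfl, ?_⟩
  have h1 : firstOrderOp T w m hm hmw h U =
      (h : ℂ) • weakDeriv U + (memLp_mul hm hmw U).toLp := rfl
  rw [h1, (weakDeriv_spec U).unique hv, smul_inv_smul₀ hhC, neg_one_smul]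
  exact neg_add_cancel_right f _

end GenericOp

/-! ### The operator on the circle -/

theorem hasPrimitives_circ : HasPrimitives circTests (fun x : ℝ => (x : Circ)) :=
  ⟨quasiMeasurePreserving_circ, fun _ _ h => h.exists_isPrimitive_circ⟩

/-- The continuous `2π`-periodic representative of an element of `H¹` of the circle. -/
abbrev evalCirc : weightedH1 circTests (fun _ => 1) →ₗ[ℂ] (ℝ → ℂ) :=
  evalMap hasPrimitives_circ fun _ => 1

theorem periodic_evalCirc (u : weightedH1 circTests (fun _ => 1)) :
    Function.Periodic (evalCirc u) (2 * Real.pi) := by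
  have hc := (evalMap_isPrimitive hasPrimitives_circ u).continuous
  have h1 : (fun x => evalCirc u (x + 2 * Real.pi)) = evalCirc u := by
    refine (Continuous.ae_eq_iff_eq volume (hc.comp (continuous_add_const _)) hc).1 ?_
    have h2 := evalMap_ae_eq hasPrimitives_circ u
    have h3 := (measurePreserving_add_right volume (2 * Real.pi)).quasiMeasurePreserving.ae h2
    filter_upwards [h2, h3] with x h4 h5
    rw [← h4]
    simp only [AddCircle.coe_add_period] at h5
    exact h5.symm
  exact fun x => congrFun h1 x

theorem circCos_coe (x : ℝ) : circCos (x : Circ) = Real.cos x := Real.cos_periodic.lift_coe x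

/-- The bridge from energy estimates over one period to `L²` norms on the circle. The base point `a`
is free, so the circle may be cut wherever the estimate needs a zero. -/
theorem circ_coercive {h ξ κ N a : ℝ} (hN : 0 ≤ N) (S : Finset ℝ)
    (hS : ∀ U G : ℝ → ℂ, IsPrimitive U G → Function.Periodic U (2 * Real.pi) →
      (∀ x ∈ S, U x = 0) → κ * ∫ x in a..a + 2 * Real.pi, ‖U x‖ ^ 2 ≤
        N * ∫ x in a..a + 2 * Real.pi,
          ‖(h : ℂ) * G x + ((ξ + Real.cos x : ℝ) : ℂ) * U x‖ * ‖U x‖)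
    (u : (PCirc h ξ).domain) (hu : evalAt hasPrimitives_circ (fun _ => 1) S u = 0) :
    κ * ‖(u : Lp ℂ 2 (volume : Measure Circ))‖ ≤ N * ‖PCirc h ξ u‖ := by
  have h1 := hS _ _ (evalMap_isPrimitive hasPrimitives_circ u) (periodic_evalCirc u)
    fun x hx => congrFun hu ⟨x, hx⟩
  have hae := evalMap_ae_eq hasPrimitives_circ (w := fun _ => 1) u
  have hop : ∀ᵐ x : ℝ, PCirc h ξ u (x : Circ) = _ :=
    firstOrderOp_ae_eq hasPrimitives_circ (w := fun _ => 1) u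
  refine mul_norm_le_of_integral_le hN ?_
  rw [← intervalIntegral_circ a, ← intervalIntegral_circ a]
  have e1 : ∫ x in a..a + 2 * Real.pi, ‖(u : Lp ℂ 2 (volume : Measure Circ)) (x : Circ)‖ ^ 2 =
      ∫ x in a..a + 2 * Real.pi, ‖evalCirc u x‖ ^ 2 := by
    refine intervalIntegral.integral_congr_ae ?_
    filter_upwards [hae] with x hx _
    rw [hx]
  rw [e1]
  refine h1.trans (le_of_eq ?_)
  congr 1
  refine intervalIntegral.integral_congr_ae ?_
  filter_upwards [hae, hop] with x hx hx' _
  rw [hx, hx', circCos_coe]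

theorem dense_domain_PCirc (h ξ : ℝ) :
    Dense ((PCirc h ξ).domain : Set (Lp ℂ 2 (volume : Measure Circ))) := by
  refine dense_weightedH1 (T := circTests) (w := fun _ => 1) fun p hp => ⟨?_, fun q hq => ?_⟩
  · simpa using (circTests.memLp p hp).1
  · have hP : ∀ p ∈ circTests.pairs,
        IsPrimitive (fun x : ℝ => p.1 (x : Circ)) (fun x : ℝ => p.2 (x : Circ)) := fun p hp => by
      have hφ : ContDiff ℝ ∞ fun x : ℝ => p.1 (x : Circ) := hp.1
      refine IsPrimitive.of_hasDerivAt (fun x => ?_) ?_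
      · rw [hp.2]
        exact ((hφ.differentiable (by simp)) x).hasDerivAt
      · simp only [hp.2]
        exact hφ.continuous_deriv (by simp)
    have h1 := ((hP p hp).mul (hP q hq)).2 0 (0 + 2 * Real.pi)
    rw [intervalIntegral_circ 0 fun y => p.2 y * q.1 y + p.1 y * q.2 y] at h1
    simp only [AddCircle.coe_add_period, sub_self] at h1
    have hpm := circTests.memLp p hp
    have hqm := circTests.memLp q hq
    have hi1 : Integrable (fun y => p.2 y * q.1 y) volume := hpm.2.integrable_mul hqm.1
    have hi2 : Integrable (fun y => p.1 y * q.2 y) volume := hpm.1.integrable_mul hqm.2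
    rw [integral_add hi1 hi2] at h1
    linear_combination -h1

theorem isClosed_PCirc {h : ℝ} (hh : h ≠ 0) (ξ : ℝ) : (PCirc h ξ).IsClosed := by
  refine isClosed_firstOrderOp (C := 1) aestronglyMeasurable_const hh (fun p hp => ?_) zero_le_one
    fun u => ?_
  · have hc : Continuous p.1 := isQuotientMap_quotient_mk'.continuous_iff.2 hp.1.continuous
    have hc' : Continuous fun y => ((ξ + circCos y : ℝ) : ℂ) * p.1 y :=
      (Complex.continuous_ofReal.comp (continuous_const.add continuous_circCos)).mul hc
    exact hc'.memLp_of_hasCompactSupport (HasCompactSupport.of_compactSpace _)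
  · have : (u.2.1.toLp : Lp ℂ 2 (volume : Measure Circ)) = u := by
      refine Lp.ext ?_
      filter_upwards [u.2.1.coeFn_toLp] with y hy
      rw [hy]; simp
    rw [this, one_mul]
    exact le_add_of_nonneg_right (norm_nonneg _)

theorem not_finiteDimensional_circ : ¬ FiniteDimensional ℂ (Lp ℂ 2 (volume : Measure Circ)) := by
  intro hfin
  -- The monomials are orthonormal for the normalized measure; independence is pulled back to
  -- continuous functions and pushed to `volume`.
  have h1 : LinearIndependent ℂ (fun n : ℤ => fourier (T := 2 * Real.pi) n) := by
    have h2 := (orthonormal_fourier (T := 2 * Real.pi)).linearIndependent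
    exact LinearIndependent.of_comp
      (ContinuousMap.toLp 2 (AddCircle.haarAddCircle (T := 2 * Real.pi)) ℂ).toLinearMap h2
  have h3 := h1.map' (ContinuousMap.toLp (E := ℂ) 2 (volume : Measure Circ) ℂ).toLinearMap
    (LinearMap.ker_eq_bot.2 (ContinuousMap.toLp_injective (𝕜 := ℂ) (volume : Measure Circ)))
  have := h3.finite
  exact not_finite ℤ

theorem exists_isSingularValueSeq_PCirc {h : ℝ} (hh : 0 < h) (ξ : ℝ) :
    ∃ t : ℕ → ℝ, IsSingularValueSeq (PCirc h ξ) t := by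
  refine exists_isSingularValueSeq not_finiteDimensional_circ (dense_domain_PCirc h ξ)
    (isClosed_PCirc hh.ne' ξ) fun κ => ?_
  obtain ⟨S, hS⟩ := exists_finset_estimate (m := fun x => ξ + Real.cos x) (by fun_prop) hh (3 * κ)
    (p := 0) (q := 0 + 2 * Real.pi) (by linarith [Real.pi_pos])
  refine ⟨S, inferInstance, evalAt hasPrimitives_circ (fun _ => 1) S, fun u hu => ?_⟩
  have := circ_coercive (by norm_num) S (fun U G hU _ h0 => hS U G hU h0) u hu
  linarith

/-! ### Lower bounds on the circle -/

/-- Linear growth of `ξ + cos` away from its zero `α`, up to half its slope there. With half-sum `A`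
and half-difference `B`, it reduces to `B cos B ≤ sin B` and `B cos A ≤ sin A`, both consequences of
`y cos y ≤ sin y` on `[0, π]`. -/
theorem sin_mul_le_cos_sub_cos {x α : ℝ} (hx : 0 ≤ x) (hxα : x ≤ α) (hα : α ≤ Real.pi) :
    Real.sin α / 2 * (α - x) ≤ Real.cos x - Real.cos α := by
  have hmul : ∀ y, 0 ≤ y → y ≤ Real.pi → y * Real.cos y ≤ Real.sin y := by
    intro y hy hyπ
    rcases hy.eq_or_lt with rfl | hy
    · simp
    rcases lt_or_ge y (Real.pi / 2) with h1 | h1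
    · have h2 := Real.lt_tan hy h1
      have h3 := Real.cos_pos_of_mem_Ioo ⟨by linarith [Real.pi_pos], h1⟩
      rw [Real.tan_eq_sin_div_cos, lt_div_iff₀ h3] at h2
      exact h2.le
    · have h2 := Real.cos_nonpos_of_pi_div_two_le_of_le h1 (by linarith [Real.pi_pos])
      have h3 := Real.sin_nonneg_of_nonneg_of_le_pi hy.le hyπ
      nlinarith
  set A := (α + x) / 2 with hA
  set B := (α - x) / 2 with hB
  have eα : α = A + B := by rw [hA, hB]; ring
  have ex : x = A - B := by rw [hA, hB]; ring
  have hB0 : 0 ≤ B := by rw [hB]; linarith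
  have hBA : B ≤ A := by rw [hA, hB]; linarith
  have hA0 : 0 ≤ A := hB0.trans hBA
  have hAπ : A ≤ Real.pi := by rw [hA]; linarith
  have hBπ : B ≤ Real.pi := hBA.trans hAπ
  have e1 : Real.cos x - Real.cos α = 2 * Real.sin A * Real.sin B := by
    rw [ex, eα, Real.cos_add, Real.cos_sub]; ring
  have e2 : Real.sin α / 2 * (α - x) =
      Real.sin A * (B * Real.cos B) + B * Real.cos A * Real.sin B := by
    rw [show α - x = 2 * B by rw [hB]; ring, eα, Real.sin_add]; ring
  have hsA := Real.sin_nonneg_of_nonneg_of_le_pi hA0 hAπ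
  have hsB := Real.sin_nonneg_of_nonneg_of_le_pi hB0 hBπ
  have h1 : B * Real.cos A ≤ Real.sin A := by
    rcases le_total 0 (Real.cos A) with h | h
    · exact (mul_le_mul_of_nonneg_right hBA h).trans (hmul A hA0 hAπ)
    · exact (mul_nonpos_of_nonneg_of_nonpos hB0 h).trans hsA
  have h2 := mul_le_mul_of_nonneg_left (hmul B hB0 hBπ) hsA
  have h3 := mul_le_mul_of_nonneg_right h1 hsB
  rw [e1, e2]
  linarith

/-- Since `1 - cos z ≥ z² / 8`, this is the inequality of arithmetic and geometric means for `δ` and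
`z² / 16`. It provides the slope when `m` has no zero. -/
theorem sqrt_mul_le_add_one_sub_cos {δ z : ℝ} (hδ : 0 ≤ δ) (hz0 : 0 ≤ z) (hz : z ≤ Real.pi) :
    √δ / 2 * z ≤ δ + (1 - Real.cos z) := by
  have h1 := Real.cos_le_one_sub_mul_cos_sq (x := z) (by rw [abs_of_nonneg hz0]; exact hz)
  have h2 := Real.sq_sqrt hδ
  have h3 : 1 / 8 * z ^ 2 ≤ 2 / Real.pi ^ 2 * z ^ 2 := by
    refine mul_le_mul_of_nonneg_right ?_ (sq_nonneg z)
    rw [div_le_div_iff₀ (by norm_num) (by positivity)]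
    nlinarith [Real.pi_le_four, Real.pi_pos]
  nlinarith [sq_nonneg (√δ - z / 4), sq_nonneg z]

theorem min_eq_sub_abs (x c r : ℝ) : min (x - (c - r)) (c + r - x) = r - |x - c| := by
  rcases le_total c x with h | h
  · rw [abs_of_nonneg (sub_nonneg.2 h), min_eq_right (by linarith)]; ring
  · rw [abs_of_nonpos (sub_nonpos.2 h), min_eq_left (by linarith)]; ring

/-- With `cos β = -ξ`, `m` is nonnegative on `[-β, β]` and nonpositive on `[β, 2π - β]`. The harmful
ends are `-β` and `2π - β`, the same point of the circle, so one condition suffices. -/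
theorem circ_lower_bound_of_abs_lt {h ξ : ℝ} (hh : 0 < h) (hξ : |ξ| < 1) :
    ∃ a : ℝ, ∀ U G : ℝ → ℂ, IsPrimitive U G → Function.Periodic U (2 * Real.pi) → U a = 0 →
      √(h * (√|1 - abs ξ| / 2)) * ∫ x in a..a + 2 * Real.pi, ‖U x‖ ^ 2 ≤
        5 * ∫ x in a..a + 2 * Real.pi,
          ‖(h : ℂ) * G x + ((ξ + Real.cos x : ℝ) : ℂ) * U x‖ * ‖U x‖ := by
  obtain ⟨hξ1, hξ2⟩ := abs_lt.1 hξ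
  set β := Real.arccos (-ξ) with hβ
  have hcos : Real.cos β = -ξ := Real.cos_arccos (by linarith) (by linarith)
  have hβ0 : 0 ≤ β := Real.arccos_nonneg _
  have hβπ : β ≤ Real.pi := Real.arccos_le_pi _
  set s := √|1 - abs ξ| / 2 with hs
  have hd : 0 < 1 - |ξ| := by linarith
  have hs0 : 0 < s := by
    rw [hs, abs_of_pos hd]
    have := Real.sqrt_pos.2 hd
    positivity
  -- `sin² β = 1 - ξ² ≥ 1 - |ξ|`.
  have hsin : s ≤ Real.sin β / 2 := by
    rw [hs, Real.sin_arccos, abs_of_pos hd]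
    gcongr
    rw [neg_sq, ← sq_abs]
    nlinarith [abs_nonneg ξ]
  have hm : Continuous fun x => ξ + Real.cos x := by fun_prop
  refine ⟨-β, fun U G hU hper h0 => ?_⟩
  have h1 := hU.estimate_of_min_le hm hh hs0 (p := -β) (q := β) (by linarith) (fun x hx => by
    have e := min_eq_sub_abs x 0 β
    rw [zero_sub, zero_add, sub_zero] at e
    have hx' : |x| ≤ β := abs_le.2 hx
    have h2 := sin_mul_le_cos_sub_cos (abs_nonneg x) hx' hβπ
    rw [Real.cos_abs, hcos] at h2
    rw [e]
    have h3 := mul_le_mul_of_nonneg_right hsin (sub_nonneg.2 hx')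
    linarith)
  have h2 := hU.estimate_of_le_neg_min hm hh hs0 (p := β) (q := -β + 2 * Real.pi) (by linarith)
    (fun x hx => by
      have e := min_eq_sub_abs x Real.pi (Real.pi - β)
      rw [sub_sub_cancel, show Real.pi + (Real.pi - β) = -β + 2 * Real.pi by ring] at e
      have hx' : |x - Real.pi| ≤ Real.pi - β :=
        abs_le.2 ⟨by linarith [hx.1], by linarith [hx.2]⟩
      have h2 := sin_mul_le_cos_sub_cos (abs_nonneg _) hx' (by linarith)
      rw [Real.cos_abs, Real.cos_sub_pi, Real.cos_pi_sub, Real.sin_pi_sub, hcos] at h2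
      rw [e]
      have h3 := mul_le_mul_of_nonneg_right hsin (sub_nonneg.2 hx')
      linarith)
  have h0' : U (-β + 2 * Real.pi) = 0 := by rw [hper, h0]
  rw [h0] at h1
  rw [h0'] at h2
  have hUc := hU.continuous
  have i1 : ∀ a b : ℝ, IntervalIntegrable (fun x => ‖U x‖ ^ 2) volume a b := fun a b =>
    Continuous.intervalIntegrable (by fun_prop) a b
  have i2 : ∀ a b : ℝ, IntervalIntegrable
      (fun x => ‖(h : ℂ) * G x + ((ξ + Real.cos x : ℝ) : ℂ) * U x‖ * ‖U x‖) volume a b :=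
    fun a b => hU.intervalIntegrable_norm_mul hm h a b
  rw [← intervalIntegral.integral_add_adjacent_intervals (i1 (-β) β) (i1 β _),
    ← intervalIntegral.integral_add_adjacent_intervals (i2 (-β) β) (i2 β _)]
  simp only [norm_zero] at h1 h2
  linarith

/-- Here `m` has constant sign, and the circle is cut where `|m|` attains its minimum `δ`: at `-π`
for positive `ξ` and at `0` for negative `ξ`. -/
theorem circ_lower_bound_of_lt_abs {h ξ : ℝ} (hh : 0 < h) (hξ : 1 < |ξ|) :
    ∃ a : ℝ, ∀ U G : ℝ → ℂ, IsPrimitive U G → Function.Periodic U (2 * Real.pi) → U a = 0 →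
      √(h * (√|1 - abs ξ| / 2)) * ∫ x in a..a + 2 * Real.pi, ‖U x‖ ^ 2 ≤
        5 * ∫ x in a..a + 2 * Real.pi,
          ‖(h : ℂ) * G x + ((ξ + Real.cos x : ℝ) : ℂ) * U x‖ * ‖U x‖ := by
  have hd : |1 - abs ξ| = |ξ| - 1 := by rw [abs_of_neg (by linarith)]; ring
  rw [hd]
  set δ := |ξ| - 1 with hδ
  have hδ0 : 0 < δ := by linarith
  have hs0 : 0 < √δ / 2 := by
    have := Real.sqrt_pos.2 hδ0
    positivity
  have hm : Continuous fun x => ξ + Real.cos x := by fun_prop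
  rcases le_total 0 ξ with hξ0 | hξ0
  · refine ⟨-Real.pi, fun U G hU hper h0 => ?_⟩
    have h1 := hU.estimate_of_min_le hm hh hs0 (p := -Real.pi) (q := -Real.pi + 2 * Real.pi)
      (by linarith [Real.pi_pos]) (fun x hx => by
        have e := min_eq_sub_abs x 0 Real.pi
        rw [zero_sub, zero_add, sub_zero] at e
        have hx' : |x| ≤ Real.pi := abs_le.2 ⟨hx.1, by linarith [hx.2]⟩
        have h2 := sqrt_mul_le_add_one_sub_cos hδ0.le (sub_nonneg.2 hx')
          (sub_le_self _ (abs_nonneg x))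
        rw [Real.cos_pi_sub, Real.cos_abs] at h2
        rw [show -Real.pi + 2 * Real.pi - x = Real.pi - x by ring, e]
        rw [abs_of_nonneg hξ0] at hδ
        linarith)
    rw [h0] at h1
    simp only [norm_zero] at h1
    linarith
  · refine ⟨0, fun U G hU hper h0 => ?_⟩
    have h1 := hU.estimate_of_le_neg_min hm hh hs0 (p := 0) (q := 0 + 2 * Real.pi)
      (by linarith [Real.pi_pos]) (fun x hx => by
        have e := min_eq_sub_abs x Real.pi Real.pi
        rw [sub_self] at e
        have hx' : |x - Real.pi| ≤ Real.pi := abs_le.2 ⟨by linarith [hx.1], by linarith [hx.2]⟩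
        have h2 := sqrt_mul_le_add_one_sub_cos hδ0.le (sub_nonneg.2 hx')
          (sub_le_self _ (abs_nonneg _))
        rw [Real.cos_pi_sub, Real.cos_abs, Real.cos_sub_pi] at h2
        rw [show 0 + 2 * Real.pi - x = Real.pi + Real.pi - x by ring, e]
        rw [abs_of_nonpos hξ0] at hδ
        linarith)
    rw [hper, h0] at h1
    simp only [norm_zero] at h1
    linarith

/-- The second singular value on the circle, uniformly in `h > 0` and `ξ ∈ ℝ`. -/
theorem exists_singularValues_PCirc {h : ℝ} (hh : 0 < h) (ξ : ℝ) :
    ∃ t : ℕ → ℝ, IsSingularValueSeq (PCirc h ξ) t ∧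
      h ^ (1 / 2 : ℝ) * |1 - abs ξ| ^ (1 / 4 : ℝ) / 10 ≤ t 1 := by
  obtain ⟨t, ht⟩ := exists_isSingularValueSeq_PCirc hh ξ
  refine ⟨t, ht, ?_⟩
  -- At `|ξ| = 1` the asserted lower bound is zero.
  rcases eq_or_ne |ξ| 1 with h1 | h1
  · rw [h1, sub_self, abs_zero, Real.zero_rpow (by norm_num), mul_zero, zero_div]
    exact ht.nonneg 1
  set d := |1 - abs ξ| with hd
  have hd0 : 0 < d := abs_pos.2 (sub_ne_zero.2 h1.symm)
  have hex : ∃ a : ℝ, ∀ U G : ℝ → ℂ, IsPrimitive U G → Function.Periodic U (2 * Real.pi) →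
      U a = 0 → √(h * (√d / 2)) * ∫ x in a..a + 2 * Real.pi, ‖U x‖ ^ 2 ≤
        5 * ∫ x in a..a + 2 * Real.pi,
          ‖(h : ℂ) * G x + ((ξ + Real.cos x : ℝ) : ℂ) * U x‖ * ‖U x‖ := by
    rcases lt_or_gt_of_ne h1 with h2 | h2
    · exact circ_lower_bound_of_abs_lt hh h2
    · exact circ_lower_bound_of_lt_abs hh h2
  obtain ⟨a, ha⟩ := hex
  have h2 : √(h * (√d / 2)) / 5 ≤ t 1 := by
    refine ht.le_of_coercive (dense_domain_PCirc h ξ)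
      (evalAt hasPrimitives_circ (fun _ => 1) {a}) (fun u hu => ?_) (by simp)
    have := circ_coercive (by norm_num) {a}
      (fun U G hU hper h0 => ha U G hU hper (h0 a (Finset.mem_singleton_self a))) u hu
    linarith
  refine le_trans ?_ h2
  have h3 : h ^ (1 / 2 : ℝ) * d ^ (1 / 4 : ℝ) = √(h * √d) := by
    rw [Real.sqrt_mul hh.le, Real.sqrt_eq_rpow, Real.sqrt_eq_rpow, Real.sqrt_eq_rpow,
      ← Real.rpow_mul hd0.le]
    norm_num
  -- The crude loss `√(1 / 2) ≥ 1 / 2` and the factor `5` of the energy estimate make up the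
  -- constant `10`.
  have h4 : √(h * √d) / 2 ≤ √(h * (√d / 2)) := by
    refine Real.le_sqrt_of_sq_le ?_
    rw [div_pow, Real.sq_sqrt (by positivity)]
    have : 0 ≤ h * √d := by positivity
    linarith
  rw [h3]
  linarith

/-! ### The operator on the line -/

theorem hasPrimitives_line : HasPrimitives lineTests (fun x : ℝ => x) :=
  ⟨Measure.QuasiMeasurePreserving.id volume, fun _ _ h => h.exists_isPrimitive_line⟩

/-- The weight in the domain of the operator on the line. -/
abbrev lineWeight (y : ℝ) : ℝ := Real.sqrt (1 + y ^ 4)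

/-- The continuous representative of an element of the domain of the operator on the line. -/
abbrev evalLine : weightedH1 lineTests lineWeight →ₗ[ℂ] (ℝ → ℂ) :=
  evalMap hasPrimitives_line lineWeight

/-- This disposes of the boundary term at `-R`. An integrable `g` need not tend to zero, but it
cannot stay above a positive constant on a half-line. -/
theorem integral_nonpos_of_intervalIntegral_le {f g : ℝ → ℝ} (hf : Integrable f)
    (hg : Integrable g) {R₀ : ℝ} (h : ∀ R ≥ R₀, ∫ x in (-R)..R, f x ≤ g (-R)) :
    ∫ x, f x ≤ 0 := by
  by_contra! hpos
  have hlim := intervalIntegral_tendsto_integral hf tendsto_neg_atTop_atBot tendsto_id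
  obtain ⟨R₁, hR₁⟩ := eventually_atTop.1 (hlim.eventually (lt_mem_nhds (half_lt_self hpos)))
  have hle : ∀ x ∈ Iic (-(max R₀ R₁)), (∫ x, f x) / 2 ≤ g x := by
    intro x hx
    have hx' : max R₀ R₁ ≤ -x := le_neg_of_le_neg hx
    have h1 := h (-x) ((le_max_left _ _).trans hx')
    have h2 := hR₁ (-x) ((le_max_right _ _).trans hx')
    rw [neg_neg] at h1 h2
    simp only [id] at h2
    linarith
  have hi : IntegrableOn (fun _ : ℝ => (∫ x, f x) / 2) (Iic (-(max R₀ R₁))) := by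
    refine Integrable.mono' hg.integrableOn aestronglyMeasurable_const ?_
    filter_upwards [ae_restrict_mem measurableSet_Iic] with x hx
    rw [Real.norm_of_nonneg (half_pos hpos).le]
    exact hle x hx
  rw [integrableOn_const_iff] at hi
  rcases hi with h0 | h0
  · simp [hpos.ne'] at h0
  · simp at h0

section Line

variable {h ξ : ℝ} (u : (PLine h ξ).domain)

/-- The function `h U' + (ξ + y²) U` for an element of the domain. -/
theorem PLine_ae_eq : ∀ᵐ x, PLine h ξ u x =
    (h : ℂ) * weakDeriv (T := lineTests) (w := lineWeight) u x +
      ((ξ + x ^ 2 : ℝ) : ℂ) * evalLine u x :=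
  firstOrderOp_ae_eq hasPrimitives_line (w := lineWeight) u

theorem evalLine_ae_eq : ∀ᵐ x, (u : Lp ℂ 2 (volume : Measure ℝ)) x = evalLine u x :=
  evalMap_ae_eq hasPrimitives_line (w := lineWeight) u

theorem evalLine_isPrimitive :
    IsPrimitive (evalLine u) (weakDeriv (T := lineTests) (w := lineWeight) u) :=
  evalMap_isPrimitive hasPrimitives_line (w := lineWeight) u

theorem integrable_evalLine_sq : Integrable fun x => ‖evalLine u x‖ ^ 2 := by
  refine (integrable_norm_sq (u : Lp ℂ 2 (volume : Measure ℝ))).congr ?_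
  filter_upwards [evalLine_ae_eq u] with x hx
  rw [hx]

theorem integrable_mul_evalLine_sq :
    Integrable fun x => (ξ + x ^ 2) ^ 2 * ‖evalLine u x‖ ^ 2 := by
  have h1 := memLp_mul (T := lineTests) (w := lineWeight) (m := fun y => ξ + y ^ 2)
    (by fun_prop) (line_bound ξ) u
  refine ((memLp_two_iff_integrable_sq_norm h1.1).1 h1).congr ?_
  filter_upwards [evalLine_ae_eq u] with x hx
  rw [hx, norm_mul, Complex.norm_real, mul_pow, Real.norm_eq_abs, sq_abs]

theorem integrable_PLine_sq : Integrable fun x =>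
    ‖(h : ℂ) * weakDeriv (T := lineTests) (w := lineWeight) u x +
      ((ξ + x ^ 2 : ℝ) : ℂ) * evalLine u x‖ ^ 2 := by
  refine (integrable_norm_sq (PLine h ξ u)).congr ?_
  filter_upwards [PLine_ae_eq u] with x hx
  rw [hx]

theorem integrable_PLine_mul : Integrable fun x =>
    ‖(h : ℂ) * weakDeriv (T := lineTests) (w := lineWeight) u x +
      ((ξ + x ^ 2 : ℝ) : ℂ) * evalLine u x‖ * ‖evalLine u x‖ := by
  refine (integrable_norm_mul_norm (PLine h ξ u) u).congr ?_
  filter_upwards [PLine_ae_eq u, evalLine_ae_eq u] with x hx hx'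
  rw [hx, hx']

theorem integral_evalLine_sq :
    ∫ x, ‖evalLine u x‖ ^ 2 = ‖(u : Lp ℂ 2 (volume : Measure ℝ))‖ ^ 2 := by
  rw [norm_sq_eq_integral]
  refine integral_congr_ae ?_
  filter_upwards [evalLine_ae_eq u] with x hx
  rw [hx]

theorem integral_PLine_sq : ∫ x, ‖(h : ℂ) * weakDeriv (T := lineTests) (w := lineWeight) u x +
      ((ξ + x ^ 2 : ℝ) : ℂ) * evalLine u x‖ ^ 2 = ‖PLine h ξ u‖ ^ 2 := by
  rw [norm_sq_eq_integral]
  refine integral_congr_ae ?_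
  filter_upwards [PLine_ae_eq u] with x hx
  rw [hx]

end Line

theorem line_coercive {h ξ κ N B R₀ : ℝ} (hN : 0 ≤ N) (S : Finset ℝ)
    (hS : ∀ U G : ℝ → ℂ, IsPrimitive U G → (∀ x ∈ S, U x = 0) → ∀ R ≥ R₀,
      κ * ∫ x in (-R)..R, ‖U x‖ ^ 2 ≤ N * (∫ x in (-R)..R,
        ‖(h : ℂ) * G x + ((ξ + x ^ 2 : ℝ) : ℂ) * U x‖ * ‖U x‖) + B * ‖U (-R)‖ ^ 2)
    (u : (PLine h ξ).domain) (hu : evalAt hasPrimitives_line lineWeight S u = 0) :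
    κ * ‖(u : Lp ℂ 2 (volume : Measure ℝ))‖ ≤ N * ‖PLine h ξ u‖ := by
  have h1 := hS _ _ (evalLine_isPrimitive u) fun x hx => congrFun hu ⟨x, hx⟩
  have i1 := (integrable_evalLine_sq u).const_mul κ
  have i2 := (integrable_PLine_mul u).const_mul N
  have h2 := integral_nonpos_of_intervalIntegral_le (i1.sub i2)
    ((integrable_evalLine_sq u).const_mul B) (R₀ := R₀) (fun R hR => by
      simp only [Pi.sub_apply]
      rw [intervalIntegral.integral_sub i1.intervalIntegrable i2.intervalIntegrable,
        intervalIntegral.integral_const_mul, intervalIntegral.integral_const_mul]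
      linarith [h1 R hR])
  simp only [Pi.sub_apply] at h2
  rw [integral_sub i1 i2, integral_const_mul, integral_const_mul] at h2
  refine mul_norm_le_of_integral_le hN ?_
  have e1 : ∫ x, ‖(u : Lp ℂ 2 (volume : Measure ℝ)) x‖ ^ 2 = ∫ x, ‖evalLine u x‖ ^ 2 := by
    refine integral_congr_ae ?_
    filter_upwards [evalLine_ae_eq u] with x hx
    rw [hx]
  have e2 : ∫ x, ‖PLine h ξ u x‖ * ‖(u : Lp ℂ 2 (volume : Measure ℝ)) x‖ =
      ∫ x, ‖(h : ℂ) * weakDeriv (T := lineTests) (w := lineWeight) u x +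
        ((ξ + x ^ 2 : ℝ) : ℂ) * evalLine u x‖ * ‖evalLine u x‖ := by
    refine integral_congr_ae ?_
    filter_upwards [PLine_ae_eq u, evalLine_ae_eq u] with x hx hx'
    rw [hx, hx']
  rw [e1, e2]
  linarith

/-- The graph norm controls `(ξ + y²) u`. -/
theorem integral_mul_evalLine_sq_le {h : ℝ} (hh : 0 ≤ h) (ξ : ℝ) (u : (PLine h ξ).domain) :
    ∫ x, (ξ + x ^ 2) ^ 2 * ‖evalLine u x‖ ^ 2 ≤ 2 * (‖PLine h ξ u‖ ^ 2 +
      (h * (1 + |ξ|) + h ^ 2 / 2) * ‖(u : Lp ℂ 2 (volume : Measure ℝ))‖ ^ 2) := by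
  set C := h * (1 + |ξ|) + h ^ 2 / 2 with hC
  have hU := evalLine_isPrimitive u
  set U := evalLine u with hUdef
  set G : ℝ → ℂ := ⇑(weakDeriv (T := lineTests) (w := lineWeight) u) with hG
  have hUc := hU.continuous
  have i1 := integrable_evalLine_sq u
  have i2 := integrable_mul_evalLine_sq u
  have i3 := integrable_PLine_sq u
  have i4 : Integrable fun x => h * ((ξ + x ^ 2) * ‖U x‖ ^ 2) := by
    refine ((i1.add i2).mono' ?_ (ae_of_all _ fun x => ?_)).const_mul h
    · exact (by fun_prop : Continuous fun x => (ξ + x ^ 2) * ‖U x‖ ^ 2).aestronglyMeasurable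
    · rw [Real.norm_eq_abs, abs_mul, abs_of_nonneg (sq_nonneg ‖U x‖)]
      have h1 : |ξ + x ^ 2| ≤ 1 + (ξ + x ^ 2) ^ 2 := by
        rw [abs_le]; constructor <;> nlinarith [sq_nonneg (ξ + x ^ 2 - 1), sq_nonneg (ξ + x ^ 2 + 1)]
      have h2 := mul_le_mul_of_nonneg_right h1 (sq_nonneg ‖U x‖)
      simp only [Pi.add_apply]
      linarith
  have hm' : Continuous fun x : ℝ => 2 * x := by fun_prop
  have hmd : ∀ x : ℝ, HasDerivAt (fun x => ξ + x ^ 2) (2 * x) x := fun x => by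
    simpa using (hasDerivAt_pow 2 x).const_add ξ
  -- Expanding the square, the cross term is `h m` times the derivative of `|U|²`. Integration by
  -- parts leaves `-2 h x |U|²` and boundary terms: the one at `R` has a good sign for `R ≥ 1 +
  -- |ξ|`, and the one at `-R` is an integrable function.
  have key := integral_nonpos_of_intervalIntegral_le
    (((i2.const_mul (1 / 2)).sub i3).sub (i1.const_mul C)) i4 (R₀ := 1 + |ξ|) (fun R hR => by
      have hR1 : 1 ≤ R := by linarith [abs_nonneg ξ]
      have hmR : 0 ≤ ξ + R ^ 2 := by nlinarith [neg_abs_le ξ]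
      have hE := normSq_mul_sub_eq hU hmd hm' (-R) R
      have hRe : IntervalIntegrable (fun x => (G x * starRingEnd ℂ (U x)).re) volume (-R) R := by
        have := (hU.1 (-R) R).mul_continuousOn hU.conj.continuous.continuousOn
        exact ⟨Complex.reCLM.integrable_comp this.1, Complex.reCLM.integrable_comp this.2⟩
      have hEi : IntervalIntegrable (fun x => 2 * x * ‖U x‖ ^ 2 +
          2 * (ξ + x ^ 2) * (G x * starRingEnd ℂ (U x)).re) volume (-R) R :=
        (Continuous.intervalIntegrable (by fun_prop) _ _).add
          (hRe.continuousOn_mul (g := fun x => 2 * (ξ + x ^ 2)) (by fun_prop))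
      have hmono : ∫ x in (-R)..R, (1 / 2 * ((ξ + x ^ 2) ^ 2 * ‖U x‖ ^ 2) -
          ‖(h : ℂ) * G x + ((ξ + x ^ 2 : ℝ) : ℂ) * U x‖ ^ 2 - C * ‖U x‖ ^ 2) ≤
          ∫ x in (-R)..R, (-h) * (2 * x * ‖U x‖ ^ 2 +
            2 * (ξ + x ^ 2) * (G x * starRingEnd ℂ (U x)).re) := by
        refine intervalIntegral.integral_mono_on (by linarith)
          (((i2.const_mul (1 / 2)).sub i3).sub (i1.const_mul C)).intervalIntegrable
          (hEi.const_mul (-h)) fun x _ => ?_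
        have e1 : ‖(h : ℂ) * G x + ((ξ + x ^ 2 : ℝ) : ℂ) * U x‖ ^ 2 = h ^ 2 * ‖G x‖ ^ 2 +
            (ξ + x ^ 2) ^ 2 * ‖U x‖ ^ 2 +
            2 * h * (ξ + x ^ 2) * (G x * starRingEnd ℂ (U x)).re := by
          simp only [← Complex.normSq_eq_norm_sq, Complex.normSq_apply, Complex.add_re,
            Complex.add_im, Complex.mul_im, Complex.ofReal_re, Complex.ofReal_im, Complex.mul_re,
            Complex.conj_re, Complex.conj_im]
          ring
        -- `2 x ≤ 1 + x²` first, then `h m ≤ h² / 2 + m² / 2`; this fixes `C`.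
        have e2 : 2 * h * x ≤ 1 / 2 * (ξ + x ^ 2) ^ 2 + C := by
          have h1 : 2 * x ≤ 1 + |ξ| + (ξ + x ^ 2) := by
            nlinarith [sq_nonneg (x - 1), neg_abs_le ξ]
          have h2 := mul_le_mul_of_nonneg_left h1 hh
          rw [hC]
          nlinarith [sq_nonneg (h - (ξ + x ^ 2))]
        have e3 := mul_le_mul_of_nonneg_right e2 (sq_nonneg ‖U x‖)
        have e4 : 0 ≤ h ^ 2 * ‖G x‖ ^ 2 := by positivity
        rw [e1]
        linarith
      rw [intervalIntegral.integral_const_mul, ← hE] at hmono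
      refine hmono.trans ?_
      have h5 : 0 ≤ h * ((ξ + R ^ 2) * ‖U R‖ ^ 2) := by positivity
      linarith)
  simp only [Pi.sub_apply] at key
  have i5 : Integrable fun x => 1 / 2 * ((ξ + x ^ 2) ^ 2 * ‖evalLine u x‖ ^ 2) -
      ‖(h : ℂ) * weakDeriv (T := lineTests) (w := lineWeight) u x +
        ((ξ + x ^ 2 : ℝ) : ℂ) * evalLine u x‖ ^ 2 := (i2.const_mul (1 / 2)).sub i3
  rw [integral_sub i5 (i1.const_mul C),
    integral_sub (i2.const_mul (1 / 2)) i3, integral_const_mul, integral_const_mul,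
    integral_PLine_sq u, integral_evalLine_sq u] at key
  linarith

theorem isClosed_PLine {h : ℝ} (hh : 0 < h) (ξ : ℝ) : (PLine h ξ).IsClosed := by
  set C := h * (1 + |ξ|) + h ^ 2 / 2 with hC
  have hC0 : 0 ≤ C := by positivity
  -- The sum of the coefficients `1 + 2 ξ² + 4 C` of `‖u‖²` and `4` of `‖P u‖²` in the bound for the
  -- weighted norm.
  set K := 5 + 2 * ξ ^ 2 + 4 * C with hK
  have hK0 : 0 ≤ K := by positivity
  refine isClosed_firstOrderOp (C := √K) (by fun_prop) hh.ne' (fun p hp => ?_)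
    (Real.sqrt_nonneg _) fun u => ?_
  · have hc : Continuous fun y : ℝ => ((ξ + y ^ 2 : ℝ) : ℂ) * p.1 y :=
      Continuous.mul (by fun_prop) hp.1.continuous
    exact hc.memLp_of_hasCompactSupport hp.2.1.mul_left
  · have h1 := integral_mul_evalLine_sq_le hh.le ξ u
    have i1 := integrable_evalLine_sq (h := h) (ξ := ξ) u
    have i2 := integrable_mul_evalLine_sq (h := h) (ξ := ξ) u
    change _ ≤ √K * (‖(u : Lp ℂ 2 (volume : Measure ℝ))‖ + ‖PLine h ξ u‖)
    have h2 : ‖u.2.1.toLp‖ ^ 2 ≤ (1 + 2 * ξ ^ 2) * (∫ x, ‖evalLine u x‖ ^ 2) +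
        2 * ∫ x, (ξ + x ^ 2) ^ 2 * ‖evalLine u x‖ ^ 2 := by
      rw [← integral_const_mul, ← integral_const_mul,
        ← integral_add (i1.const_mul _) (i2.const_mul _), norm_sq_eq_integral]
      refine integral_mono_ae (integrable_norm_sq _) ((i1.const_mul _).add (i2.const_mul _)) ?_
      filter_upwards [u.2.1.coeFn_toLp, evalLine_ae_eq (h := h) (ξ := ξ) u] with x hx hx'
      rw [hx, hx', norm_mul, Complex.norm_real, mul_pow, Real.norm_eq_abs, sq_abs,
        Real.sq_sqrt (by positivity)]
      have h3 : 1 + x ^ 4 ≤ 1 + 2 * ξ ^ 2 + 2 * (ξ + x ^ 2) ^ 2 := by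
        nlinarith [sq_nonneg (2 * ξ + x ^ 2)]
      have h4 := mul_le_mul_of_nonneg_right h3 (sq_nonneg ‖evalLine u x‖)
      linarith
    rw [← hC] at h1
    rw [integral_evalLine_sq (h := h) (ξ := ξ) u] at h2
    set a := ‖(u : Lp ℂ 2 (volume : Measure ℝ))‖ with ha
    set b := ‖PLine h ξ u‖ with hb
    have ha0 : 0 ≤ a := norm_nonneg _
    have hb0 : 0 ≤ b := norm_nonneg _
    refine le_trans (Real.le_sqrt_of_sq_le h2) ?_
    rw [← Real.sqrt_sq (add_nonneg ha0 hb0), ← Real.sqrt_mul hK0]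
    refine Real.sqrt_le_sqrt ?_
    have h5 : (1 + 2 * ξ ^ 2 + 4 * C) * a ^ 2 + 4 * b ^ 2 ≤ K * a ^ 2 + K * b ^ 2 := by
      have : 0 ≤ (1 + 2 * ξ ^ 2 + 4 * C) * b ^ 2 := by positivity
      have : 0 ≤ a ^ 2 := by positivity
      rw [hK]; linarith
    have h6 : 0 ≤ K * (2 * a * b) := by positivity
    have h7 : K * (a + b) ^ 2 = K * a ^ 2 + K * b ^ 2 + K * (2 * a * b) := by ring
    rw [h7]
    linarith

theorem dense_domain_PLine (h ξ : ℝ) :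
    Dense ((PLine h ξ).domain : Set (Lp ℂ 2 (volume : Measure ℝ))) := by
  refine dense_weightedH1 (T := lineTests) (w := lineWeight) fun p hp => ⟨?_, fun q hq => ?_⟩
  · have hc : Continuous fun y : ℝ => (lineWeight y : ℂ) * p.1 y :=
      Continuous.mul (by fun_prop) hp.1.continuous
    exact hc.memLp_of_hasCompactSupport hp.2.1.mul_left
  · obtain ⟨hp1, hp2, hp3⟩ := hp
    obtain ⟨hq1, hq2, hq3⟩ := hq
    have hP : IsPrimitive p.1 p.2 := by
      rw [hp3]
      exact IsPrimitive.of_hasDerivAt (fun x => ((hp1.differentiable (by simp)) x).hasDerivAt)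
        (hp1.continuous_deriv (by simp))
    have hc : Continuous p.2 := by rw [hp3]; exact hp1.continuous_deriv (by simp)
    rw [hq3]
    exact integral_primitive_mul_deriv hP hc.locallyIntegrable hq1 hq2

theorem not_finiteDimensional_line : ¬ FiniteDimensional ℂ (Lp ℂ 2 (volume : Measure ℝ)) := by
  intro hfin
  let e : ℕ → Lp ℂ 2 (volume : Measure ℝ) := fun n =>
    indicatorConstLp 2 (measurableSet_Ioc (a := (n : ℝ)) (b := n + 1)) (by simp) (1 : ℂ)
  have hne : ∀ n, e n ≠ 0 := fun n => by
    rw [← norm_ne_zero_iff, norm_indicatorConstLp (by norm_num) (by norm_num)]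
    simp
  have hor : Pairwise fun i j => inner ℂ (e i) (e j) = 0 := by
    intro i j hij
    have hd : Ioc (i : ℝ) (i + 1) ∩ Ioc (j : ℝ) (j + 1) = ∅ := by
      ext x
      simp only [mem_inter_iff, mem_Ioc, mem_empty_iff_false, iff_false]
      rintro ⟨⟨h1, h2⟩, h3, h4⟩
      apply hij
      have h5 : (i : ℝ) < j + 1 := by linarith
      have h6 : (j : ℝ) < i + 1 := by linarith
      norm_cast at h5 h6
      omega
    refine (L2.inner_indicatorConstLp_one_indicatorConstLp_one measurableSet_Ioc
      measurableSet_Ioc (by simp) (by simp)).trans ?_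
    rw [hd]
    simp
  have := (linearIndependent_of_ne_zero_of_inner_eq_zero hne hor).finite
  exact not_finite ℕ

theorem exists_isSingularValueSeq_PLine {h : ℝ} (hh : 0 < h) (ξ : ℝ) :
    ∃ t : ℕ → ℝ, IsSingularValueSeq (PLine h ξ) t := by
  refine exists_isSingularValueSeq not_finiteDimensional_line (dense_domain_PLine h ξ)
    (isClosed_PLine hh ξ) fun κ => ?_
  have hm : Continuous fun x : ℝ => ξ + x ^ 2 := by fun_prop
  -- Beyond `R₀` one has `m ≥ 3 κ`; the `3` cancels the factor lost on the compact middle piece. The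
  -- point `R₀` joins the finite set because it is the harmful end of `[R₀, R]`.
  set R₀ := 1 + |3 * κ| + |ξ| with hR₀
  have hR₀1 : 1 ≤ R₀ := by linarith [abs_nonneg (3 * κ), abs_nonneg ξ]
  have hlarge : ∀ x, R₀ ≤ |x| → 3 * κ ≤ ξ + x ^ 2 := by
    intro x hx
    rw [← sq_abs x]
    nlinarith [neg_abs_le ξ, le_abs_self (3 * κ)]
  obtain ⟨S, hS⟩ := exists_finset_estimate hm hh (3 * κ) (p := -R₀) (q := R₀) (by linarith)
  refine ⟨(insert R₀ S : Finset ℝ), inferInstance,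
    evalAt hasPrimitives_line lineWeight (insert R₀ S), fun u hu => ?_⟩
  have := line_coercive (κ := 3 * κ) (N := 3) (B := h / 2) (R₀ := R₀) (by norm_num) (insert R₀ S)
    (fun U G hU h0 R hR => by
      have h1 := hU.estimate_of_le hm hh.le (p := -R) (q := -R₀) (by linarith) (fun x hx =>
        hlarge x (by rw [abs_of_nonpos (by linarith [hx.2])]; linarith [hx.2]))
      have h2 := hS U G hU fun x hx => h0 x (Finset.mem_insert_of_mem hx)
      have h3 := hU.estimate_of_le hm hh.le (p := R₀) (q := R) hR (fun x hx =>
        hlarge x (hx.1.trans (le_abs_self x)))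
      rw [h0 R₀ (Finset.mem_insert_self _ _)] at h3
      have hUc := hU.continuous
      have i1 : ∀ a b : ℝ, IntervalIntegrable (fun x => ‖U x‖ ^ 2) volume a b := fun a b =>
        Continuous.intervalIntegrable (by fun_prop) a b
      have i2 : ∀ a b : ℝ, IntervalIntegrable
          (fun x => ‖(h : ℂ) * G x + ((ξ + x ^ 2 : ℝ) : ℂ) * U x‖ * ‖U x‖) volume a b :=
        fun a b => hU.intervalIntegrable_norm_mul hm h a b
      have hnn : ∀ a b : ℝ, a ≤ b → 0 ≤ ∫ x in a..b,
          ‖(h : ℂ) * G x + ((ξ + x ^ 2 : ℝ) : ℂ) * U x‖ * ‖U x‖ := fun a b hab =>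
        intervalIntegral.integral_nonneg hab fun x _ => by positivity
      have h4 := hnn (-R) (-R₀) (by linarith)
      have h5 := hnn R₀ R hR
      rw [← intervalIntegral.integral_add_adjacent_intervals (i1 (-R) (-R₀)) (i1 (-R₀) R),
        ← intervalIntegral.integral_add_adjacent_intervals (i1 (-R₀) R₀) (i1 R₀ R),
        ← intervalIntegral.integral_add_adjacent_intervals (i2 (-R) (-R₀)) (i2 (-R₀) R),
        ← intervalIntegral.integral_add_adjacent_intervals (i2 (-R₀) R₀) (i2 R₀ R)]
      simp only [norm_zero] at h3
      linarith) u hu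
  linarith

/-- The second singular value on the line, uniformly in `h > 0` and `ξ < 0`. -/
theorem exists_singularValues_PLine {h ξ : ℝ} (hh : 0 < h) (hξ : ξ < 0) :
    ∃ t : ℕ → ℝ, IsSingularValueSeq (PLine h ξ) t ∧
      h ^ (1 / 2 : ℝ) * |ξ| ^ (1 / 4 : ℝ) / 5 ≤ t 1 := by
  obtain ⟨t, ht⟩ := exists_isSingularValueSeq_PLine hh ξ
  refine ⟨t, ht, ?_⟩
  have hξ0 : 0 < |ξ| := abs_pos.2 hξ.ne
  set a := √|ξ| with ha
  have ha0 : 0 < a := Real.sqrt_pos.2 hξ0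
  have ha2 : ξ = -(a * a) := by
    rw [ha, Real.mul_self_sqrt hξ0.le, abs_of_neg hξ, neg_neg]
  have hm : Continuous fun x : ℝ => ξ + x ^ 2 := by fun_prop
  have h3 : h ^ (1 / 2 : ℝ) * |ξ| ^ (1 / 4 : ℝ) = √(h * a) := by
    rw [ha, Real.sqrt_mul hh.le, Real.sqrt_eq_rpow, Real.sqrt_eq_rpow, Real.sqrt_eq_rpow,
      ← Real.rpow_mul hξ0.le]
    norm_num
  rw [h3]
  refine ht.le_of_coercive (dense_domain_PLine h ξ)
    (evalAt hasPrimitives_line lineWeight {a}) (fun u hu => ?_) (by simp)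
  -- On `[-R, -a]`, `[-a, a]`, `[a, R]` the signs of `m = x² - a²` are `+`, `-`, `+`. The harmful
  -- ends are `-R`, `a`, `a`: the first vanishes in the limit and the others by `U a = 0`. Factoring
  -- `m` shows that slope `a` is available throughout.
  have := line_coercive (κ := √(h * a)) (N := 5) (B := h / 2 * 5) (R₀ := a) (by norm_num) {a}
    (fun U G hU h0 R hR => by
      have h0' := h0 a (Finset.mem_singleton_self a)
      have h1 := hU.estimate_of_min_le hm hh ha0 (p := -R) (q := -a) (by linarith) (fun x hx => by
        have h1 : a * min (x - -R) (-a - x) ≤ a * (-a - x) :=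
          mul_le_mul_of_nonneg_left (min_le_right _ _) ha0.le
        rw [ha2]
        nlinarith [hx.2])
      have h2 := hU.estimate_of_le_neg_min hm hh ha0 (p := -a) (q := a) (by linarith)
        (fun x hx => by
          rw [ha2]
          rcases le_total 0 x with hx0 | hx0
          · have h1 : a * min (x - -a) (a - x) ≤ a * (a - x) :=
              mul_le_mul_of_nonneg_left (min_le_right _ _) ha0.le
            nlinarith [hx.2]
          · have h1 : a * min (x - -a) (a - x) ≤ a * (x - -a) :=
              mul_le_mul_of_nonneg_left (min_le_left _ _) ha0.le
            nlinarith [hx.1])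
      have h3 := hU.estimate_of_min_le hm hh ha0 (p := a) (q := R) hR (fun x hx => by
        have h1 : a * min (x - a) (R - x) ≤ a * (x - a) :=
          mul_le_mul_of_nonneg_left (min_le_left _ _) ha0.le
        rw [ha2]
        nlinarith [hx.1])
      rw [h0'] at h2 h3
      have hUc := hU.continuous
      have i1 : ∀ a b : ℝ, IntervalIntegrable (fun x => ‖U x‖ ^ 2) volume a b := fun a b =>
        Continuous.intervalIntegrable (by fun_prop) a b
      have i2 : ∀ a b : ℝ, IntervalIntegrable
          (fun x => ‖(h : ℂ) * G x + ((ξ + x ^ 2 : ℝ) : ℂ) * U x‖ * ‖U x‖) volume a b :=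
        fun a b => hU.intervalIntegrable_norm_mul hm h a b
      rw [← intervalIntegral.integral_add_adjacent_intervals (i1 (-R) (-a)) (i1 (-a) R),
        ← intervalIntegral.integral_add_adjacent_intervals (i1 (-a) a) (i1 a R),
        ← intervalIntegral.integral_add_adjacent_intervals (i2 (-R) (-a)) (i2 (-a) R),
        ← intervalIntegral.integral_add_adjacent_intervals (i2 (-a) a) (i2 a R)]
      simp only [norm_zero] at h2 h3
      linarith) u hu
  linarith

/-- A positive continuous function has a positive lower bound on a compact set. -/
theorem exists_pos_le_of_isCompact {K : Set ℝ} (hK : IsCompact K) {f : ℝ → ℝ}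
    (hf : ContinuousOn f K) (hpos : ∀ x ∈ K, 0 < f x) : ∃ c : ℝ, 0 < c ∧ ∀ x ∈ K, c ≤ f x := by
  rcases K.eq_empty_or_nonempty with rfl | hne
  · exact ⟨1, one_pos, by simp⟩
  · obtain ⟨x, hx, hmin⟩ := hK.exists_isMinOn hne hf
    exact ⟨f x, hpos x hx, fun y hy => hmin hy⟩

end SmallSV

end

/-! ### The four lower bounds -/

theorem theorem2p5 :
    -- `Y = ℝ`, `ξ` in a compact subset of `]-∞, 0[`
    (∀ K : Set ℝ, IsCompact K → K ⊆ Set.Iio 0 →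
      ∃ C : ℝ, 0 < C ∧ ∃ h₀ : ℝ, 0 < h₀ ∧ ∀ h ∈ Set.Ioc 0 h₀, ∀ ξ ∈ K,
        ∃ t : ℕ → ℝ, SmallSV.IsSingularValueSeq (SmallSV.PLine h ξ) t ∧
          h ^ (1 / 2 : ℝ) / C ≤ t 1) ∧
    -- `Y = S¹`, `ξ` in a compact subset of `]-1, 1[`
    (∀ K : Set ℝ, IsCompact K → K ⊆ Set.Ioo (-1) 1 →
      ∃ C : ℝ, 0 < C ∧ ∃ h₀ : ℝ, 0 < h₀ ∧ ∀ h ∈ Set.Ioc 0 h₀, ∀ ξ ∈ K,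
        ∃ t : ℕ → ℝ, SmallSV.IsSingularValueSeq (SmallSV.PCirc h ξ) t ∧
          h ^ (1 / 2 : ℝ) / C ≤ t 1) ∧
    -- `Y = ℝ`, degenerate range and large negative `ξ`
    (∀ C₀ : ℝ, 0 < C₀ →
      ∃ C : ℝ, 0 < C ∧ ∃ h₀ : ℝ, 0 < h₀ ∧ ∀ h ∈ Set.Ioc 0 h₀, ∀ ξ : ℝ,
        ((C₀ * h ^ (2 / 3 : ℝ) ≤ -ξ ∧ -ξ ≤ 1 / C₀) ∨ C₀ ≤ -ξ) →
        ∃ t : ℕ → ℝ, SmallSV.IsSingularValueSeq (SmallSV.PLine h ξ) t ∧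
          h ^ (1 / 2 : ℝ) * |ξ| ^ (1 / 4 : ℝ) / C ≤ t 1) ∧
    -- `Y = S¹`, degenerate ranges near `ξ = -1` and `ξ = 1`
    (∀ C₀ : ℝ, 0 < C₀ →
      ∃ C : ℝ, 0 < C ∧ ∃ h₀ : ℝ, 0 < h₀ ∧ ∀ h ∈ Set.Ioc 0 h₀, ∀ ξ : ℝ,
        ((C₀ * h ^ (2 / 3 : ℝ) ≤ 1 + ξ ∧ 1 + ξ ≤ 1 / C₀) ∨
          (C₀ * h ^ (2 / 3 : ℝ) ≤ 1 - ξ ∧ 1 - ξ ≤ 1 / C₀)) →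
        ∃ t : ℕ → ℝ, SmallSV.IsSingularValueSeq (SmallSV.PCirc h ξ) t ∧
          h ^ (1 / 2 : ℝ) * |1 - abs ξ| ^ (1 / 4 : ℝ) / C ≤ t 1) := by
  refine ⟨fun K hK hKs => ?_, fun K hK hKs => ?_, fun C₀ hC₀ => ?_, fun C₀ _ => ?_⟩
  · obtain ⟨c, hc, hcK⟩ := SmallSV.exists_pos_le_of_isCompact hK
      (f := fun ξ => |ξ| ^ (1 / 4 : ℝ))
      (continuous_abs.rpow_const fun _ => Or.inr (by norm_num)).continuousOn
      fun ξ hξ => Real.rpow_pos_of_pos (abs_pos.2 (ne_of_lt (hKs hξ))) _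
    -- `c` bounds the factor `|ξ|^(1/4)` from below on `K`, so it is absorbed into the constant.
    refine ⟨5 / c, by positivity, 1, one_pos, fun h hh ξ hξ => ?_⟩
    obtain ⟨t, ht, hle⟩ := SmallSV.exists_singularValues_PLine hh.1 (hKs hξ)
    refine ⟨t, ht, le_trans ?_ hle⟩
    rw [div_div_eq_mul_div]
    have := Real.rpow_nonneg hh.1.le (1 / 2 : ℝ)
    have := hcK ξ hξ
    gcongr
  · obtain ⟨c, hc, hcK⟩ := SmallSV.exists_pos_le_of_isCompact hK
      (f := fun ξ => |1 - abs ξ| ^ (1 / 4 : ℝ))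
      ((continuous_const.sub continuous_abs).abs.rpow_const
        fun _ => Or.inr (by norm_num)).continuousOn
      fun ξ hξ => Real.rpow_pos_of_pos
        (abs_pos.2 (sub_ne_zero.2 (abs_lt.2 (hKs hξ)).ne')) _
    refine ⟨10 / c, by positivity, 1, one_pos, fun h hh ξ hξ => ?_⟩
    obtain ⟨t, ht, hle⟩ := SmallSV.exists_singularValues_PCirc hh.1 ξ
    refine ⟨t, ht, le_trans ?_ hle⟩
    rw [div_div_eq_mul_div]
    have := Real.rpow_nonneg hh.1.le (1 / 2 : ℝ)
    have := hcK ξ hξ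
    gcongr
  · refine ⟨5, by norm_num, 1, one_pos, fun h hh ξ hξ => ?_⟩
    refine SmallSV.exists_singularValues_PLine hh.1 ?_
    have h1 : 0 < C₀ * h ^ (2 / 3 : ℝ) := mul_pos hC₀ (Real.rpow_pos_of_pos hh.1 _)
    rcases hξ with hξ | hξ
    · linarith [hξ.1]
    · linarith
  -- For `C₀ < 1 / 2` these ranges can reach beyond `[-1, 1]`; the circle bound covers every real
  -- `ξ`.
  · exact ⟨10, by norm_num, 1, one_pos, fun h hh ξ _ =>
      SmallSV.exists_singularValues_PCirc hh.1 ξ⟩
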